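/- Let $n\ge 2$, let $T=(C_2)^n=\langle t_1,\dots,t_n \mid t_i^2=1,\ t_it_j=t_jt_i\rangle$, and let $H=\mathbb{C}T$ be its group algebra, a Hopf algebra with $\triangle(t)=t\otimes t$ and $\epsilon(t)=1$ for $t\in T$. Put $$\mu=\prod_{1\le j<i\le n}\mu_{ij},\qquad \mu_{ij}=\tfrac12\,(1\otimes 1+t_i\otimes 1+1\otimes t_j-t_i\otimes t_j)\in H\otimes H .$$ Let $V$ be a complex vector space with basis $x_1,\dots,x_n$, on which $H$ acts by $t_i\rhd x_j=(-1)^{\delta_{ij}}x_j$. Let $(-1)_{ij}=1$ if $i=j$ and $(-1)_{ij}=-1$ otherwise, and let $$S_{-1}(V)=T(V)/(x_i\otimes x_j-(-1)_{ij}\,x_j\otimes x_i\mid 1\le i,j\le n),\qquad \textstyle\bigwedge_{-1}(V)=T(V)/(x_i\otimes x_j+(-1)_{ij}\,x_j\otimes x_i\mid 1\le i,j\le n).$$ For an $H$-module algebra $A$ with product $m$ and a counital $2$-cocycle $\mu$ of $H$ (an invertible $\mu\in H\otimes H$ with $(\mu\otimes 1)(\triangle\otimes\mathrm{id})(\mu)=(1\otimes\mu)(\mathrm{id}\otimes\triangle)(\mu)$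 and $(\epsilon\otimes\mathrm{id})(\mu)=1=(\mathrm{id}\otimes\epsilon)(\mu)$), the Drinfeld twist $A_\mu$ is the vector space $A$ with product $a\otimes b\mapsto m(\mu^{-1}\rhd(a\otimes b))$. A connected $\mathbb{N}$-graded, locally finite-dimensional $\mathbb{C}$-algebra $A$ is Koszul if the $A$-module $\mathbb{C}=A/\bigoplus_{i>0}A_i$ has a linear graded free resolution, that is, a resolution by graded free $A$-modules $P_i$ generated in degree $i$, with degree-preserving maps. All the algebras below are graded with $V$ in degree $1$, and the twists carry the grading of the untwisted algebras. Then: 1. $\mu$ is a counital $2$-cocycle of $H$, and $\mu^{-1}=\mu$. 2. (Twisting the symmetric algebra.) $S(V)=T(V)/(R)$ for $R=\mathrm{span}\{x_i\otimes x_j-x_j\otimes x_i\}$. The action of $H$ on $V$ extends, with $T$ acting by algebra endomorphisms, to a degree-preserving action that makes $S(V)$ an $H$-module algebra. The space $R_\mu=\mu\rhd R$ is the span of the $x_i\otimes x_j-(-1)_{ij}x_j\otimes x_i$, and the identity of $V$ induces an isomorphism of graded algebras $S(V)_\mu\cong T(V)/(R_\mu)=S_{-1}(V)$. The algebras $S(V)_\mu$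 and $S_{-1}(V)$ are Koszul. 3. (Twisting the exterior algebra.) $\bigwedge(V)=T(V)/(R)$ for $R=\mathrm{span}\{x_i\otimes x_j+x_j\otimes x_i\}$. The action of $H$ on $V$ extends, with $T$ acting by algebra endomorphisms, to a degree-preserving action that makes $\bigwedge(V)$ an $H$-module algebra. The space $R_\mu=\mu\rhd R$ is the span of the $x_i\otimes x_j+(-1)_{ij}x_j\otimes x_i$, which is $\mathrm{span}\{x_i\otimes x_i,\ x_i\otimes x_j-x_j\otimes x_i\mid i\ne j\}$, and the identity of $V$ induces an isomorphism of graded algebras $\bigwedge(V)_\mu\cong T(V)/(R_\mu)=\bigwedge_{-1}(V)$. The algebras $\bigwedge(V)_\mu$ and $\bigwedge_{-1}(V)$ are Koszul. -/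

import Mathlib

open scoped TensorProduct

noncomputable section

namespace KoszulTwist

universe u

/-! ### Tensor products of representations, module algebras, cocycles -/

section General

variable {k H K A B : Type*} [CommRing k] [Ring H] [Ring K] [Ring A] [Algebra k A]

/-- The action of `H ⊗ K` on `M ⊗ N` obtained from representations of `H` on `M` and of `K`
on `N`: `(h ⊗ h') ▷ (m ⊗ n) = (h ▷ m) ⊗ (h' ▷ n)`. -/
def tensorAction {M N : Type*} [AddCommGroup M] [Module k M] [AddCommGroup N] [Module k N]
    [Algebra k H] [Algebra k K]
    (ρ : H →ₐ[k] Module.End k M) (σ : K →ₐ[k] Module.End k N) :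
    H ⊗[k] K →ₐ[k] Module.End k (M ⊗[k] N) :=
  (Module.endTensorEndAlgHom (R := k) (S := k) (A := k) (M := M) (N := N)).comp
    (Algebra.TensorProduct.map ρ σ)

@[simp] theorem tensorAction_tmul_tmul {M N : Type*} [AddCommGroup M] [Module k M]
    [AddCommGroup N] [Module k N] [Algebra k H] [Algebra k K]
    (ρ : H →ₐ[k] Module.End k M) (σ : K →ₐ[k] Module.End k N) (h : H) (h' : K) (m : M) (n : N) :
    tensorAction ρ σ (h ⊗ₜ h') (m ⊗ₜ n) = ρ h m ⊗ₜ σ h' n := rfl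

/-- A representation `ρ` of the bialgebra `H` on the algebra `A` makes `A` an `H`-module algebra:
`h ▷ (a b) = m (Δ(h) ▷ (a ⊗ b))` and `h ▷ 1 = ε(h) 1`. -/
structure IsModuleAlgebra [Bialgebra k H] (ρ : H →ₐ[k] Module.End k A) : Prop where
  map_mul : ∀ (h : H) (a b : A),
    ρ h (a * b) = LinearMap.mul' k A (tensorAction ρ ρ (Coalgebra.comul (R := k) h) (a ⊗ₜ b))
  map_one : ∀ h : H, ρ h 1 = Coalgebra.counit (R := k) h • (1 : A)

/-- `μ` is a counital 2-cocycle of `H`: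
`(μ ⊗ 1) (Δ ⊗ id)(μ) = (1 ⊗ μ) (id ⊗ Δ)(μ)` and `(ε ⊗ id)(μ) = 1 = (id ⊗ ε)(μ)`, where the first
equation is read in `H ⊗ (H ⊗ H)` through the associativity isomorphism. -/
structure IsCounitalTwoCocycle [Bialgebra k H] (μ : (H ⊗[k] H)ˣ) : Prop where
  cocycle :
    Algebra.TensorProduct.assoc k k k H H H
      (((μ : H ⊗[k] H) ⊗ₜ[k] (1 : H)) *
        Algebra.TensorProduct.map (Bialgebra.comulAlgHom k H) (AlgHom.id k H) (μ : H ⊗[k] H)) =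
    ((1 : H) ⊗ₜ[k] (μ : H ⊗[k] H)) *
      Algebra.TensorProduct.map (AlgHom.id k H) (Bialgebra.comulAlgHom k H) (μ : H ⊗[k] H)
  counit_left :
    Algebra.TensorProduct.lid k H
      (Algebra.TensorProduct.map (Bialgebra.counitAlgHom k H) (AlgHom.id k H)
        (μ : H ⊗[k] H)) = 1
  counit_right :
    Algebra.TensorProduct.rid k k H
      (Algebra.TensorProduct.map (AlgHom.id k H) (Bialgebra.counitAlgHom k H)
        (μ : H ⊗[k] H)) = 1

/-! ### The Drinfeld twist of a module algebra -/

variable [Bialgebra k H]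

/-- The twisted product `m_μ = m ∘ (μ⁻¹ ▷ -)`. -/
def twistMul (ρ : H →ₐ[k] Module.End k A) (μ : (H ⊗[k] H)ˣ) : A ⊗[k] A →ₗ[k] A :=
  LinearMap.mul' k A ∘ₗ tensorAction ρ ρ ((μ⁻¹ : (H ⊗[k] H)ˣ) : H ⊗[k] H)

theorem tensorAction_lTensor_mul {ρ : H →ₐ[k] Module.End k A} (hρ : IsModuleAlgebra ρ)
    (x : H ⊗[k] H) (a : A) (y : A ⊗[k] A) :
    tensorAction ρ ρ x (a ⊗ₜ LinearMap.mul' k A y) =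
      (LinearMap.mul' k A).lTensor A (tensorAction ρ (tensorAction ρ ρ)
        (Algebra.TensorProduct.map (AlgHom.id k H) (Bialgebra.comulAlgHom k H) x) (a ⊗ₜ y)) := by
  induction x with
  | zero => simp
  | add x y hx hy => simp [hx, hy]
  | tmul h h' =>
    induction y with
    | zero => simp
    | add x y hx hy => simp only [map_add, TensorProduct.tmul_add, hx, hy]
    | tmul b c => simp [hρ.map_mul]

theorem tensorAction_rTensor_mul {ρ : H →ₐ[k] Module.End k A} (hρ : IsModuleAlgebra ρ)
    (x : H ⊗[k] H) (a : A) (y : A ⊗[k] A) :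
    tensorAction ρ ρ x (LinearMap.mul' k A y ⊗ₜ a) =
      (LinearMap.mul' k A).rTensor A (tensorAction (tensorAction ρ ρ) ρ
        (Algebra.TensorProduct.map (Bialgebra.comulAlgHom k H) (AlgHom.id k H) x) (y ⊗ₜ a)) := by
  induction x with
  | zero => simp
  | add x y hx hy => simp [hx, hy]
  | tmul h h' =>
    induction y with
    | zero => simp
    | add x y hx hy => simp only [map_add, TensorProduct.add_tmul, hx, hy]
    | tmul b c => simp [hρ.map_mul]

theorem tensorAction_assoc (ρ : H →ₐ[k] Module.End k A) (z : (H ⊗[k] H) ⊗[k] H)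
    (y : (A ⊗[k] A) ⊗[k] A) :
    TensorProduct.assoc k A A A (tensorAction (tensorAction ρ ρ) ρ z y) =
      tensorAction ρ (tensorAction ρ ρ) (Algebra.TensorProduct.assoc k k k H H H z)
        (TensorProduct.assoc k A A A y) := by
  induction z with
  | zero => simp
  | add x y hx hy => simp [hx, hy]
  | tmul w h =>
    induction w with
    | zero => simp
    | add x y hx hy => simp [hx, hy, TensorProduct.add_tmul]
    | tmul h₁ h₂ =>
      induction y with
      | zero => simp
      | add x y hx hy => simp only [map_add, hx, hy]
      | tmul w c =>
        induction w with
        | zero => simp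
        | add x y hx hy => simp only [map_add, TensorProduct.add_tmul, hx, hy]
        | tmul a b => simp

theorem mul_lTensor_assoc (y : (A ⊗[k] A) ⊗[k] A) :
    LinearMap.mul' k A ((LinearMap.mul' k A).lTensor A (TensorProduct.assoc k A A A y)) =
      LinearMap.mul' k A ((LinearMap.mul' k A).rTensor A y) := by
  induction y with
  | zero => simp
  | add x y hx hy => simp [hx, hy]
  | tmul w c =>
    induction w with
    | zero => simp
    | add x y hx hy => simp [hx, hy, TensorProduct.add_tmul]
    | tmul a b => simp [mul_assoc]

/-- The cocycle equation for the inverse. -/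
theorem IsCounitalTwoCocycle.cocycle_inv {μ : (H ⊗[k] H)ˣ} (hμ : IsCounitalTwoCocycle μ) :
    Algebra.TensorProduct.assoc k k k H H H
      (Algebra.TensorProduct.map (Bialgebra.comulAlgHom k H) (AlgHom.id k H)
        ((μ⁻¹ : (H ⊗[k] H)ˣ) : H ⊗[k] H) * (((μ⁻¹ : (H ⊗[k] H)ˣ) : H ⊗[k] H) ⊗ₜ[k] (1 : H))) =
    Algebra.TensorProduct.map (AlgHom.id k H) (Bialgebra.comulAlgHom k H)
        ((μ⁻¹ : (H ⊗[k] H)ˣ) : H ⊗[k] H) * ((1 : H) ⊗ₜ[k] ((μ⁻¹ : (H ⊗[k] H)ˣ) : H ⊗[k] H)) := by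
  let as := (Algebra.TensorProduct.assoc k k k H H H).toAlgHom
  let f₁ : H ⊗[k] H →ₐ[k] H ⊗[k] (H ⊗[k] H) :=
    as.comp (Algebra.TensorProduct.includeLeft (R := k) (S := k) (A := H ⊗[k] H) (B := H))
  let f₂ : H ⊗[k] H →ₐ[k] H ⊗[k] (H ⊗[k] H) :=
    as.comp (Algebra.TensorProduct.map (Bialgebra.comulAlgHom k H) (AlgHom.id k H))
  let f₃ : H ⊗[k] H →ₐ[k] H ⊗[k] (H ⊗[k] H) :=
    Algebra.TensorProduct.includeRight (R := k) (A := H) (B := H ⊗[k] H)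
  let f₄ : H ⊗[k] H →ₐ[k] H ⊗[k] (H ⊗[k] H) :=
    Algebra.TensorProduct.map (AlgHom.id k H) (Bialgebra.comulAlgHom k H)
  have h : Units.map (f₁ : H ⊗[k] H →* H ⊗[k] (H ⊗[k] H)) μ * Units.map (f₂ : H ⊗[k] H →* H ⊗[k] (H ⊗[k] H)) μ =
      Units.map (f₃ : H ⊗[k] H →* H ⊗[k] (H ⊗[k] H)) μ * Units.map (f₄ : H ⊗[k] H →* H ⊗[k] (H ⊗[k] H)) μ := by
    ext
    have := hμ.cocycle
    rw [map_mul] at this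
    exact this
  have h' := congrArg (fun u : (H ⊗[k] (H ⊗[k] H))ˣ => ((u⁻¹ : (H ⊗[k] (H ⊗[k] H))ˣ) :
    H ⊗[k] (H ⊗[k] H))) h
  simp only [mul_inv_rev, ← map_inv, Units.val_mul, Units.coe_map] at h'
  rw [map_mul]
  exact h'

theorem twistMul_assoc {ρ : H →ₐ[k] Module.End k A} (hρ : IsModuleAlgebra ρ)
    {μ : (H ⊗[k] H)ˣ} (hμ : IsCounitalTwoCocycle μ) (a b c : A) :
    twistMul ρ μ (twistMul ρ μ (a ⊗ₜ b) ⊗ₜ c) = twistMul ρ μ (a ⊗ₜ twistMul ρ μ (b ⊗ₜ c)) := by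
  have hL : ∀ (x : H ⊗[k] H) (y : A ⊗[k] A),
      tensorAction ρ ρ x y ⊗ₜ[k] c = tensorAction (tensorAction ρ ρ) ρ (x ⊗ₜ 1) (y ⊗ₜ c) := by
    intro x y; simp
  have hR : ∀ (x : H ⊗[k] H) (y : A ⊗[k] A),
      a ⊗ₜ[k] tensorAction ρ ρ x y = tensorAction ρ (tensorAction ρ ρ) (1 ⊗ₜ x) (a ⊗ₜ y) := by
    intro x y; simp
  simp only [twistMul, LinearMap.comp_apply]
  rw [tensorAction_rTensor_mul hρ, tensorAction_lTensor_mul hρ, hL, hR, ← Module.End.mul_apply,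
    ← Module.End.mul_apply, ← map_mul, ← map_mul, ← hμ.cocycle_inv, ← mul_lTensor_assoc,
    tensorAction_assoc, TensorProduct.assoc_tmul]

theorem twistMul_one_left {ρ : H →ₐ[k] Module.End k A} (hρ : IsModuleAlgebra ρ)
    {μ : (H ⊗[k] H)ˣ} (hμ : IsCounitalTwoCocycle μ) (a : A) :
    twistMul ρ μ (1 ⊗ₜ a) = a := by
  have key : ∀ x : H ⊗[k] H, LinearMap.mul' k A (tensorAction ρ ρ x (1 ⊗ₜ a)) =
      ρ (Algebra.TensorProduct.lid k H
        (Algebra.TensorProduct.map (Bialgebra.counitAlgHom k H) (AlgHom.id k H) x)) a := by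
    intro x
    induction x with
    | zero => simp
    | add x y hx hy => simp [hx, hy]
    | tmul h h' => simp [hρ.map_one]
  let f : H ⊗[k] H →ₐ[k] H := (Algebra.TensorProduct.lid k H).toAlgHom.comp
    (Algebra.TensorProduct.map (Bialgebra.counitAlgHom k H) (AlgHom.id k H))
  have h1 : Units.map (f : H ⊗[k] H →* H) μ = 1 := by
    ext; exact hμ.counit_left
  have h2 : f ((μ⁻¹ : (H ⊗[k] H)ˣ) : H ⊗[k] H) = 1 := by
    have := congrArg (fun u : Hˣ => ((u⁻¹ : Hˣ) : H)) h1
    simp only [← map_inv, Units.coe_map, inv_one, Units.val_one] at this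
    exact this
  rw [twistMul, LinearMap.comp_apply, key]
  change ρ (f _) a = a
  rw [h2]; simp

theorem twistMul_one_right {ρ : H →ₐ[k] Module.End k A} (hρ : IsModuleAlgebra ρ)
    {μ : (H ⊗[k] H)ˣ} (hμ : IsCounitalTwoCocycle μ) (a : A) :
    twistMul ρ μ (a ⊗ₜ 1) = a := by
  have key : ∀ x : H ⊗[k] H, LinearMap.mul' k A (tensorAction ρ ρ x (a ⊗ₜ 1)) =
      ρ (Algebra.TensorProduct.rid k k H
        (Algebra.TensorProduct.map (AlgHom.id k H) (Bialgebra.counitAlgHom k H) x)) a := by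
    intro x
    induction x with
    | zero => simp
    | add x y hx hy => simp [hx, hy]
    | tmul h h' => simp [hρ.map_one]
  let f : H ⊗[k] H →ₐ[k] H := (Algebra.TensorProduct.rid k k H).toAlgHom.comp
    (Algebra.TensorProduct.map (AlgHom.id k H) (Bialgebra.counitAlgHom k H))
  have h1 : Units.map (f : H ⊗[k] H →* H) μ = 1 := by
    ext; exact hμ.counit_right
  have h2 : f ((μ⁻¹ : (H ⊗[k] H)ˣ) : H ⊗[k] H) = 1 := by
    have := congrArg (fun u : Hˣ => ((u⁻¹ : Hˣ) : H)) h1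
    simp only [← map_inv, Units.coe_map, inv_one, Units.val_one] at this
    exact this
  rw [twistMul, LinearMap.comp_apply, key]
  change ρ (f _) a = a
  rw [h2]; simp

/-- The Drinfeld twist `A_μ`: the vector space `A` with the product `a ⊗ b ↦ m (μ⁻¹ ▷ (a ⊗ b))`. -/
def DrinfeldTwist (ρ : H →ₐ[k] Module.End k A) (_ : IsModuleAlgebra ρ)
    (μ : (H ⊗[k] H)ˣ) (_ : IsCounitalTwoCocycle μ) : Type _ := A

namespace DrinfeldTwist

variable {ρ : H →ₐ[k] Module.End k A} {hρ : IsModuleAlgebra ρ}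
  {μ : (H ⊗[k] H)ˣ} {hμ : IsCounitalTwoCocycle μ}

instance : AddCommGroup (DrinfeldTwist ρ hρ μ hμ) := inferInstanceAs (AddCommGroup A)

instance : Module k (DrinfeldTwist ρ hρ μ hμ) := inferInstanceAs (Module k A)

/-- The identity map, as a linear isomorphism from `A` onto `A_μ`. -/
def of : A ≃ₗ[k] DrinfeldTwist ρ hρ μ hμ := LinearEquiv.refl k A

instance : Ring (DrinfeldTwist ρ hρ μ hμ) where
  __ := (inferInstance : AddCommGroup (DrinfeldTwist ρ hρ μ hμ))
  mul a b := of (twistMul ρ μ (of.symm a ⊗ₜ of.symm b))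
  one := of 1
  mul_assoc a b c := twistMul_assoc hρ hμ a b c
  one_mul a := twistMul_one_left hρ hμ a
  mul_one a := twistMul_one_right hρ hμ a
  left_distrib a b c := by
    change of (twistMul ρ μ (of.symm a ⊗ₜ of.symm (b + c))) = of _ + of _
    rw [map_add, TensorProduct.tmul_add, map_add, map_add]
  right_distrib a b c := by
    change of (twistMul ρ μ (of.symm (a + b) ⊗ₜ of.symm c)) = of _ + of _
    rw [map_add, TensorProduct.add_tmul, map_add, map_add]
  zero_mul a := by
    change of (twistMul ρ μ (of.symm 0 ⊗ₜ of.symm a)) = 0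
    simp
  mul_zero a := by
    change of (twistMul ρ μ (of.symm a ⊗ₜ of.symm 0)) = 0
    simp

theorem mul_def (a b : DrinfeldTwist ρ hρ μ hμ) :
    a * b = of (twistMul ρ μ (of.symm a ⊗ₜ of.symm b)) := rfl

instance : Algebra k (DrinfeldTwist ρ hρ μ hμ) := Algebra.ofModule
  (fun r a b => by rw [mul_def, mul_def, map_smul, ← TensorProduct.smul_tmul', map_smul, map_smul])
  (fun r a b => by rw [mul_def, mul_def, map_smul, TensorProduct.tmul_smul, map_smul, map_smul])

/-- `A_μ` carries the grading of `A`. -/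
def grading (ρ : H →ₐ[k] Module.End k A) (hρ : IsModuleAlgebra ρ)
    (μ : (H ⊗[k] H)ˣ) (hμ : IsCounitalTwoCocycle μ) (𝒜 : ℕ → Submodule k A) (m : ℕ) :
    Submodule k (DrinfeldTwist ρ hρ μ hμ) :=
  (𝒜 m).map (of : A ≃ₗ[k] DrinfeldTwist ρ hρ μ hμ).toLinearMap

end DrinfeldTwist

end General

/-! ### Koszul algebras -/

section Koszul

variable {k : Type*} {A : Type*} [Field k] [Ring A] [Algebra k A]

/-- The degree `m` part of the free graded left `A`-module `A(-n)^(ι)`, whose basis elements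
all have degree `n`. -/
def shiftedFree (𝒜 : ℕ → Submodule k A) (n : ℕ) (ι : Type) (m : ℕ) : Set (ι →₀ A) :=
  {p | if n ≤ m then ∀ i, p i ∈ 𝒜 (m - n) else p = 0}

/-- A linear graded free resolution
`⋯ → P₂ → P₁ → P₀ → k → 0` of the left `A`-module `k`, on which `A` acts through `aug`, with `k`
placed in degree `0`: each `P n` is a free graded left module generated in degree `n`, and the
maps are `A`-linear and degree-preserving. -/
structure LinearFreeResolution (𝒜 : ℕ → Submodule k A) (aug : A →ₐ[k] k) where
  ι : ℕ → Type
  d : ∀ n, (ι (n + 1) →₀ A) →ₗ[A] (ι n →₀ A)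
  e : (ι 0 →₀ A) →ₗ[k] k
  e_smul : ∀ (a : A) (p : ι 0 →₀ A), e (a • p) = aug a * e p
  d_degree : ∀ n m, ∀ p ∈ shiftedFree 𝒜 (n + 1) (ι (n + 1)) m, d n p ∈ shiftedFree 𝒜 n (ι n) m
  e_degree : ∀ m, m ≠ 0 → ∀ p ∈ shiftedFree 𝒜 0 (ι 0) m, e p = 0
  exact_succ : ∀ n, Function.Exact (d (n + 1)) (d n)
  exact_zero : Function.Exact (d 0) e
  surjective : Function.Surjective e

/-- `A = ⨁ 𝒜 m` is a connected, locally finite-dimensional `ℕ`-graded algebra. -/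
structure IsConnectedGraded (𝒜 : ℕ → Submodule k A) : Prop where
  gradedMonoid : SetLike.GradedMonoid 𝒜
  isInternal : DirectSum.IsInternal 𝒜
  connected : 𝒜 0 = 1
  injective : Function.Injective (algebraMap k A)
  finite : ∀ m, Module.Finite k (𝒜 m)

/-- `A` is Koszul: it is connected graded and locally finite-dimensional, and `k`, an `A`-module
through the augmentation (the algebra map that kills the positive degrees), has a linear graded
free resolution. -/
structure IsKoszul (𝒜 : ℕ → Submodule k A) : Prop where
  graded : IsConnectedGraded 𝒜
  resolution : ∃ aug : A →ₐ[k] k, (∀ m, m ≠ 0 → ∀ a ∈ 𝒜 m, aug a = 0) ∧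
    Nonempty (LinearFreeResolution 𝒜 aug)

end Koszul

/-! ### Quadratic algebras and quantum symmetric and exterior algebras -/

section Quadratic

variable {k : Type*} [Field k] {V : Type*} [AddCommGroup V] [Module k V]

/-- The embedding of `V ⊗ V` as the degree two part of the tensor algebra `T(V)`. -/
def tensorTwo : V ⊗[k] V →ₗ[k] TensorAlgebra k V :=
  LinearMap.mul' k (TensorAlgebra k V) ∘ₗ
    TensorProduct.map (TensorAlgebra.ι k) (TensorAlgebra.ι k)

/-- The relations `r = 0` in `T(V)`, for `r ∈ R ⊆ V ⊗ V`. -/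
def QuadRel (R : Submodule k (V ⊗[k] V)) (a b : TensorAlgebra k V) : Prop :=
  ∃ r ∈ R, a = tensorTwo r ∧ b = 0

/-- `T(V)/(R)` for a space of quadratic relations `R ⊆ V ⊗ V`. -/
abbrev QuadAlg (R : Submodule k (V ⊗[k] V)) : Type _ := RingQuot (QuadRel R)

/-- The canonical map `V → T(V)/(R)`. -/
def QuadAlg.gen (R : Submodule k (V ⊗[k] V)) : V →ₗ[k] QuadAlg R :=
  (RingQuot.mkAlgHom k (QuadRel R)).toLinearMap ∘ₗ TensorAlgebra.ι k

/-- The degree `m` part of an algebra generated in degree one by the image of `f : V → A`: the span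
of the products of `m` generators. -/
def powGrading {A : Type*} [Ring A] [Algebra k A] (f : V →ₗ[k] A) (m : ℕ) : Submodule k A :=
  LinearMap.range f ^ m

/-- The relations `x i ⊗ x j - q i j x j ⊗ x i`. -/
def symRel {n : ℕ} (x : Module.Basis (Fin n) k V) (q : Fin n → Fin n → k) :
    Submodule k (V ⊗[k] V) :=
  Submodule.span k (Set.range fun p : Fin n × Fin n =>
    x p.1 ⊗ₜ[k] x p.2 - q p.1 p.2 • x p.2 ⊗ₜ[k] x p.1)

/-- The relations `x i ⊗ x j + q i j x j ⊗ x i`. -/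
def extRel {n : ℕ} (x : Module.Basis (Fin n) k V) (q : Fin n → Fin n → k) :
    Submodule k (V ⊗[k] V) :=
  Submodule.span k (Set.range fun p : Fin n × Fin n =>
    x p.1 ⊗ₜ[k] x p.2 + q p.1 p.2 • x p.2 ⊗ₜ[k] x p.1)

/-- The quantum symmetric algebra `S_q(V)`. -/
abbrev QuantumSym {n : ℕ} (x : Module.Basis (Fin n) k V) (q : Fin n → Fin n → k) : Type _ :=
  QuadAlg (symRel x q)

/-- The quantum exterior algebra `Λ_q(V)`. -/
abbrev QuantumExt {n : ℕ} (x : Module.Basis (Fin n) k V) (q : Fin n → Fin n → k) : Type _ :=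
  QuadAlg (extRel x q)

/-- The matrix `(-1)`: ones on the diagonal and `-1` elsewhere. -/
def negOne (n : ℕ) : Fin n → Fin n → ℂ := fun i j => if i = j then 1 else -1

end Quadratic

/-! ### The group algebra of `(C₂)ⁿ` and its cocycle -/

section Group

/-- `T = (C₂)ⁿ`, with `C₂ = {1, -1}`. -/
abbrev CTwoPow (n : ℕ) : Type := Fin n → ℤˣ

/-- The generator `t i` of `(C₂)ⁿ`. -/
def t {n : ℕ} (i : Fin n) : CTwoPow n := Pi.mulSingle i (-1)

/-- The Hopf algebra `H = ℂT`, with its standard coproduct and counit. -/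
abbrev GroupAlg (n : ℕ) : Type := MonoidAlgebra ℂ (CTwoPow n)

/-- `t i` as an element of `ℂT`. -/
def tH {n : ℕ} (i : Fin n) : GroupAlg n := MonoidAlgebra.of ℂ (CTwoPow n) (t i)

/-- `μ_ij = 1/2 (1 ⊗ 1 + t_i ⊗ 1 + 1 ⊗ t_j - t_i ⊗ t_j)`. -/
def muFactor {n : ℕ} (i j : Fin n) : GroupAlg n ⊗[ℂ] GroupAlg n :=
  (1 / 2 : ℂ) • (1 ⊗ₜ 1 + tH i ⊗ₜ 1 + 1 ⊗ₜ tH j - tH i ⊗ₜ tH j)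

/-- `μ = ∏_{j < i} μ_ij`. -/
def muElem (n : ℕ) : GroupAlg n ⊗[ℂ] GroupAlg n :=
  ∏ p : Fin n × Fin n with p.2 < p.1, muFactor p.1 p.2

theorem t_sq {n : ℕ} (i : Fin n) : t i * t i = 1 := by
  rw [t, ← Pi.mulSingle_mul]; simp

theorem tH_sq {n : ℕ} (i : Fin n) : tH i * tH i = 1 := by
  rw [tH, ← map_mul, t_sq, map_one]

/-- `1/2 (1 + a + b - a b)` in a commutative algebra. -/
def bic {R : Type*} [CommRing R] [Algebra ℂ R] (a b : R) : R :=
  algebraMap ℂ R (1 / 2) * (1 + a + b - a * b)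

theorem half_mul_two {R : Type*} [CommRing R] [Algebra ℂ R] :
    algebraMap ℂ R (1 / 2) * 2 = 1 := by
  rw [← map_ofNat (algebraMap ℂ R) 2, ← map_mul]; norm_num

theorem bic_sq {R : Type*} [CommRing R] [Algebra ℂ R] {a b : R} (ha : a * a = 1)
    (hb : b * b = 1) : bic a b * bic a b = 1 := by
  have hc := half_mul_two (R := R)
  rw [bic]
  set c := algebraMap ℂ R (1 / 2)
  linear_combination (c ^ 2 * (1 - b) ^ 2) * ha + (2 * c ^ 2 * (1 - a)) * hb + (2 * c + 1) * hc

theorem bic_mul_left {R : Type*} [CommRing R] [Algebra ℂ R] {a b d : R}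
    (hd : d * d = 1) : bic (a * b) d = bic a d * bic b d := by
  have hc := half_mul_two (R := R)
  rw [bic, bic, bic]
  set c := algebraMap ℂ R (1 / 2)
  linear_combination (-c ^ 2 * (1 - a) * (1 - b)) * hd - c * (1 + a * b + d - a * b * d) * hc

theorem bic_comm {R : Type*} [CommRing R] [Algebra ℂ R] (a b : R) : bic a b = bic b a := by
  rw [bic, bic]; ring

theorem map_bic {R S : Type*} [CommRing R] [Algebra ℂ R] [CommRing S] [Algebra ℂ S]
    (f : R →ₐ[ℂ] S) (a b : R) : f (bic a b) = bic (f a) (f b) := by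
  simp [bic]

theorem bic_one_left {R : Type*} [CommRing R] [Algebra ℂ R] (b : R) : bic 1 b = 1 := by
  rw [bic]
  linear_combination half_mul_two (R := R)

theorem muFactor_eq_bic {n : ℕ} (i j : Fin n) :
    muFactor i j = bic (tH i ⊗ₜ[ℂ] (1 : GroupAlg n)) ((1 : GroupAlg n) ⊗ₜ[ℂ] tH j) := by
  rw [bic, muFactor, Algebra.TensorProduct.tmul_mul_tmul, one_mul, mul_one]
  exact Algebra.smul_def (A := GroupAlg n ⊗[ℂ] GroupAlg n) _ _

theorem tH_tmul_one_sq {n : ℕ} (i : Fin n) :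
    (tH i ⊗ₜ[ℂ] (1 : GroupAlg n)) * (tH i ⊗ₜ[ℂ] (1 : GroupAlg n)) = 1 := by
  rw [Algebra.TensorProduct.tmul_mul_tmul, tH_sq, one_mul, Algebra.TensorProduct.one_def]

theorem one_tmul_tH_sq {n : ℕ} (i : Fin n) :
    ((1 : GroupAlg n) ⊗ₜ[ℂ] tH i) * ((1 : GroupAlg n) ⊗ₜ[ℂ] tH i) = 1 := by
  rw [Algebra.TensorProduct.tmul_mul_tmul, tH_sq, one_mul, Algebra.TensorProduct.one_def]

theorem muFactor_sq {n : ℕ} (i j : Fin n) : muFactor i j * muFactor i j = 1 := by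
  rw [muFactor_eq_bic]
  exact bic_sq (tH_tmul_one_sq i) (one_tmul_tH_sq j)

theorem muElem_sq (n : ℕ) : muElem n * muElem n = 1 := by
  rw [muElem, ← Finset.prod_mul_distrib]
  exact Finset.prod_eq_one fun p _ => muFactor_sq p.1 p.2

/-- `μ` as an invertible element, with `μ⁻¹ = μ`. -/
def mu (n : ℕ) : (GroupAlg n ⊗[ℂ] GroupAlg n)ˣ := ⟨muElem n, muElem n, muElem_sq n, muElem_sq n⟩

theorem mu_val (n : ℕ) : (mu n : GroupAlg n ⊗[ℂ] GroupAlg n) =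
    ∏ p : Fin n × Fin n with p.2 < p.1,
      bic (tH p.1 ⊗ₜ[ℂ] (1 : GroupAlg n)) ((1 : GroupAlg n) ⊗ₜ[ℂ] tH p.2) := by
  change muElem n = _
  simp only [muElem, muFactor_eq_bic]

theorem comul_tH {n : ℕ} (i : Fin n) :
    Coalgebra.comul (R := ℂ) (tH i) = tH i ⊗ₜ[ℂ] tH i := by
  simp [tH]

theorem counit_tH {n : ℕ} (i : Fin n) : Coalgebra.counit (R := ℂ) (tH i) = 1 := by
  simp [tH]

theorem map_mu {n : ℕ} {S : Type*} [CommRing S] [Algebra ℂ S]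
    (f : GroupAlg n ⊗[ℂ] GroupAlg n →ₐ[ℂ] S) :
    f (mu n : GroupAlg n ⊗[ℂ] GroupAlg n) =
    ∏ p : Fin n × Fin n with p.2 < p.1,
      bic (f (tH p.1 ⊗ₜ[ℂ] (1 : GroupAlg n))) (f ((1 : GroupAlg n) ⊗ₜ[ℂ] tH p.2)) := by
  rw [mu_val, map_prod]
  exact Finset.prod_congr rfl fun p _ => map_bic f _ _

theorem mu_isCounitalTwoCocycle (n : ℕ) : IsCounitalTwoCocycle (mu n) where
  cocycle := by
    let as := (Algebra.TensorProduct.assoc ℂ ℂ ℂ (GroupAlg n) (GroupAlg n) (GroupAlg n)).toAlgHom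
    have h1 := map_mu (S := GroupAlg n ⊗[ℂ] (GroupAlg n ⊗[ℂ] GroupAlg n)) (as.comp (Algebra.TensorProduct.includeLeft (R := ℂ) (S := ℂ)
      (A := GroupAlg n ⊗[ℂ] GroupAlg n) (B := GroupAlg n)))
    have h2 := map_mu (S := GroupAlg n ⊗[ℂ] (GroupAlg n ⊗[ℂ] GroupAlg n)) (as.comp (Algebra.TensorProduct.map (Bialgebra.comulAlgHom ℂ (GroupAlg n))
      (AlgHom.id ℂ (GroupAlg n))))
    have h3 := map_mu (S := GroupAlg n ⊗[ℂ] (GroupAlg n ⊗[ℂ] GroupAlg n)) (Algebra.TensorProduct.includeRight (R := ℂ) (A := GroupAlg n)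
      (B := GroupAlg n ⊗[ℂ] GroupAlg n))
    have h4 := map_mu (S := GroupAlg n ⊗[ℂ] (GroupAlg n ⊗[ℂ] GroupAlg n)) (Algebra.TensorProduct.map (AlgHom.id ℂ (GroupAlg n))
      (Bialgebra.comulAlgHom ℂ (GroupAlg n)))
    rw [map_mul]
    refine (congrArg₂ (· * ·) h1 h2).trans (Eq.trans ?_ (congrArg₂ (· * ·) h3 h4).symm)
    simp only [← Finset.prod_mul_distrib]
    refine Finset.prod_congr rfl fun p _ => ?_
    let X : GroupAlg n ⊗[ℂ] (GroupAlg n ⊗[ℂ] GroupAlg n) := tH p.1 ⊗ₜ 1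
    let Y (i : Fin n) : GroupAlg n ⊗[ℂ] (GroupAlg n ⊗[ℂ] GroupAlg n) := 1 ⊗ₜ (tH i ⊗ₜ 1)
    let Z : GroupAlg n ⊗[ℂ] (GroupAlg n ⊗[ℂ] GroupAlg n) := 1 ⊗ₜ (1 ⊗ₜ tH p.2)
    have hX : X * X = 1 := by simp [X, tH_sq, Algebra.TensorProduct.one_def]
    have hZ : Z * Z = 1 := by simp [Z, tH_sq, Algebra.TensorProduct.one_def]
    have key : bic X (Y p.2) * bic (X * Y p.1) Z = bic (Y p.1) Z * bic X (Y p.2 * Z) := by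
      rw [bic_mul_left hZ, bic_comm X (Y p.2 * Z), bic_mul_left hX, bic_comm (Y p.2) X,
        bic_comm Z X]
      ring
    have eXY : X * Y p.1 = tH p.1 ⊗ₜ (tH p.1 ⊗ₜ 1) := by simp [X, Y]
    have eYZ : Y p.2 * Z = 1 ⊗ₜ (tH p.2 ⊗ₜ tH p.2) := by simp [Y, Z]
    rw [eXY, eYZ] at key
    simpa [as, X, Y, Z, comul_tH, Algebra.TensorProduct.one_def] using key
  counit_left := by
    rw [mu_val, map_prod, map_prod]
    refine Finset.prod_eq_one fun p _ => ?_
    have h := map_bic ((Algebra.TensorProduct.lid ℂ (GroupAlg n)).toAlgHom.comp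
      (Algebra.TensorProduct.map (Bialgebra.counitAlgHom ℂ (GroupAlg n))
        (AlgHom.id ℂ (GroupAlg n))))
      (tH p.1 ⊗ₜ[ℂ] (1 : GroupAlg n)) ((1 : GroupAlg n) ⊗ₜ[ℂ] tH p.2)
    refine h.trans ?_
    simp [counit_tH, bic_one_left]
  counit_right := by
    rw [mu_val, map_prod, map_prod]
    refine Finset.prod_eq_one fun p _ => ?_
    have h := map_bic ((Algebra.TensorProduct.rid ℂ ℂ (GroupAlg n)).toAlgHom.comp
      (Algebra.TensorProduct.map (AlgHom.id ℂ (GroupAlg n))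
        (Bialgebra.counitAlgHom ℂ (GroupAlg n))))
      (tH p.1 ⊗ₜ[ℂ] (1 : GroupAlg n)) ((1 : GroupAlg n) ⊗ₜ[ℂ] tH p.2)
    refine h.trans ?_
    rw [bic_comm]
    simp [counit_tH, bic_one_left]

/-! ### The actions of `(C₂)ⁿ` on `V`, `S(V)` and `Λ(V)` -/

variable {n : ℕ} {V : Type*} [AddCommGroup V] [Module ℂ V]

/-- The diagonal action of `T` on `V`: an element `s = (s_1, …, s_n)` of `(C₂)ⁿ` sends `x j` to
`s_j x j`; in particular `t i ▷ x j = (-1)^{δ_ij} x j`. -/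
def diagAction (x : Module.Basis (Fin n) ℂ V) : CTwoPow n →* Module.End ℂ V where
  toFun s := x.constr ℂ fun j => ((s j : ℤ) : ℂ) • x j
  map_one' := x.ext fun j => by simp
  map_mul' s s' := x.ext fun j => by simp [smul_smul, mul_comm]

/-- The action of `H = ℂT` on `V`. -/
def vAction (x : Module.Basis (Fin n) ℂ V) : GroupAlg n →ₐ[ℂ] Module.End ℂ V :=
  MonoidAlgebra.lift ℂ (Module.End ℂ V) (CTwoPow n) (diagAction x)

/-- The linear representation underlying an action by algebra endomorphisms. -/
def algToEnd (A : Type*) [Ring A] [Algebra ℂ A] : (A →ₐ[ℂ] A) →* Module.End ℂ A where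
  toFun f := f.toLinearMap
  map_one' := rfl
  map_mul' _ _ := rfl

theorem algToEnd_apply {A : Type*} [Ring A] [Algebra ℂ A] (f : A →ₐ[ℂ] A) (a : A) :
    algToEnd A f a = f a := rfl

/-- The representation of `ℂT` on an algebra on which `T` acts by algebra endomorphisms. -/
def algAction {A : Type*} [Ring A] [Algebra ℂ A] (φ : CTwoPow n →* (A →ₐ[ℂ] A)) :
    GroupAlg n →ₐ[ℂ] Module.End ℂ A :=
  MonoidAlgebra.lift ℂ (Module.End ℂ A) (CTwoPow n) ((algToEnd A).comp φ)

theorem algAction_isModuleAlgebra {A : Type*} [Ring A] [Algebra ℂ A]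
    (φ : CTwoPow n →* (A →ₐ[ℂ] A)) : IsModuleAlgebra (algAction φ) where
  map_mul h a b := by
    induction h using MonoidAlgebra.induction_on with
    | of s => simp [algAction, algToEnd_apply]
    | add f g hf hg => simp [hf, hg]
    | smul r f hf => simp [hf]
  map_one h := by
    induction h using MonoidAlgebra.induction_on with
    | of s => simp [algAction, algToEnd_apply]
    | add f g hf hg => simp [hf, hg, add_smul]
    | smul r f hf => simp [hf, mul_smul]

/-- The action of `T` on `S(V)` by algebra endomorphisms extending the action on `V`. -/
def symAlgAction (x : Module.Basis (Fin n) ℂ V) :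
    CTwoPow n →* (SymmetricAlgebra ℂ V →ₐ[ℂ] SymmetricAlgebra ℂ V) where
  toFun s := SymmetricAlgebra.lift (SymmetricAlgebra.ι ℂ V ∘ₗ diagAction x s)
  map_one' := by ext; simp
  map_mul' s s' := by ext; simp

/-- The action of `T` on `Λ(V)` by algebra endomorphisms extending the action on `V`. -/
def extAlgAction (x : Module.Basis (Fin n) ℂ V) :
    CTwoPow n →* (ExteriorAlgebra ℂ V →ₐ[ℂ] ExteriorAlgebra ℂ V) where
  toFun s := ExteriorAlgebra.map (diagAction x s)
  map_one' := by ext; simp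
  map_mul' s s' := by ext; simp

/-- The action of `H = ℂT` on `S(V)`. -/
def symAction (x : Module.Basis (Fin n) ℂ V) :
    GroupAlg n →ₐ[ℂ] Module.End ℂ (SymmetricAlgebra ℂ V) := algAction (symAlgAction x)

/-- The action of `H = ℂT` on `Λ(V)`. -/
def extAction (x : Module.Basis (Fin n) ℂ V) :
    GroupAlg n →ₐ[ℂ] Module.End ℂ (ExteriorAlgebra ℂ V) := algAction (extAlgAction x)

theorem symAction_isModuleAlgebra (x : Module.Basis (Fin n) ℂ V) :
    IsModuleAlgebra (symAction x) := algAction_isModuleAlgebra _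

theorem extAction_isModuleAlgebra (x : Module.Basis (Fin n) ℂ V) :
    IsModuleAlgebra (extAction x) := algAction_isModuleAlgebra _

/-- The Drinfeld twist `S(V)_μ`. -/
abbrev SymTwist (x : Module.Basis (Fin n) ℂ V) : Type _ :=
  DrinfeldTwist (symAction x) (symAction_isModuleAlgebra x) (mu n) (mu_isCounitalTwoCocycle n)

/-- The Drinfeld twist `Λ(V)_μ`. -/
abbrev ExtTwist (x : Module.Basis (Fin n) ℂ V) : Type _ :=
  DrinfeldTwist (extAction x) (extAction_isModuleAlgebra x) (mu n) (mu_isCounitalTwoCocycle n)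

/-- The grading of `S(V)_μ`, which is that of `S(V)`. -/
def symTwistGrading (x : Module.Basis (Fin n) ℂ V) : ℕ → Submodule ℂ (SymTwist x) :=
  DrinfeldTwist.grading _ _ _ _ (powGrading (SymmetricAlgebra.ι ℂ V))

/-- The grading of `Λ(V)_μ`, which is that of `Λ(V)`. -/
def extTwistGrading (x : Module.Basis (Fin n) ℂ V) : ℕ → Submodule ℂ (ExtTwist x) :=
  DrinfeldTwist.grading _ _ _ _ (powGrading (ExteriorAlgebra.ι ℂ (M := V)))

end Group

end KoszulTwist

end

open KoszulTwist

noncomputable section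

namespace KoszulTwist

/-! ### Quadratic algebras: universal property and grading -/

section QuadAlg

variable {k : Type*} [Field k] {V : Type*} [AddCommGroup V] [Module k V]

/-! Each factor of `mu` is multiplicative in each of its two group elements (`bic_mul_left`), which
gives the cocycle identity factor by factor. On `x i ⊗ w` the generator is a weight vector, and `mu`
acts by applying the product of the `t j`, `j < i`, to `w` (`mu_tmul_of_left`). So `x i ⊗ x j`
changes sign exactly when `j < i`, and in `x i ⊗ x j + c i j x j ⊗ x i` with `i ≠ j` exactly one
term changes sign: up to a global sign, `c` becomes `c * negOne n`. The symmetric case `c = -1` and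
the exterior case `c = 1` are treated together through `extRel`.

The universal property maps the quadratic algebra of the twisted relations to the twist. The inverse
comes from letting the untwisted algebra act on that quadratic algebra, each generator acting by
left multiplication composed with the same group element, and evaluating at `1`
(`exists_twist_equiv`).

For Koszulness, `S_{-1}(V)` has a basis of monomials indexed by exponents `a`, and `Λ_{-1}(V)` one
indexed by subsets `b`. The space spanned by the pairs `(a, b)` carries a Koszul differential `kosD`
and a de Rham differential `derD`, both with signs from the anticommuting variables. Both square to
zero, and their anticommutator is multiplication by the total degree (`kosD_mul_derD_add`). In
characteristic zero each, divided by the total degree, contracts the other away from `(0, ∅)`. With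
differential `kosD` the complex resolves `ℂ` over `S_{-1}(V)`; with `derD` it does so over
`Λ_{-1}(V)`. `isKoszul_of_coord` turns this into Koszulness, and `IsKoszul.of_algEquiv` carries it
to the twists. -/

theorem tensorTwo_tmul (v w : V) :
    tensorTwo (k := k) (v ⊗ₜ w) = TensorAlgebra.ι k v * TensorAlgebra.ι k w := by
  simp [tensorTwo]

theorem lift_tensorTwo {B : Type*} [Semiring B] [Algebra k B] (f : V →ₗ[k] B) (r : V ⊗[k] V) :
    TensorAlgebra.lift k f (tensorTwo r) = LinearMap.mul' k B (TensorProduct.map f f r) := by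
  induction r with
  | zero => simp
  | add a b ha hb => simp only [map_add, ha, hb]
  | tmul v w => simp [tensorTwo_tmul]

namespace QuadAlg

variable {R : Submodule k (V ⊗[k] V)}

/-- The universal property of `T(V)/(R)`. -/
def lift {B : Type*} [Semiring B] [Algebra k B] (f : V →ₗ[k] B)
    (hf : ∀ r ∈ R, TensorAlgebra.lift k f (tensorTwo r) = 0) : QuadAlg R →ₐ[k] B :=
  RingQuot.liftAlgHom k ⟨TensorAlgebra.lift k f, by
    rintro _ _ ⟨r, hr, rfl, rfl⟩
    rw [hf r hr, map_zero]⟩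

@[simp] theorem lift_gen {B : Type*} [Semiring B] [Algebra k B] (f : V →ₗ[k] B)
    (hf : ∀ r ∈ R, TensorAlgebra.lift k f (tensorTwo r) = 0) (v : V) :
    lift f hf (gen R v) = f v := by
  simp [lift, gen]

theorem algHom_ext {B : Type*} [Semiring B] [Algebra k B] {f g : QuadAlg R →ₐ[k] B}
    (h : ∀ v, f (gen R v) = g (gen R v)) : f = g :=
  RingQuot.ringQuot_ext' k _ _ (TensorAlgebra.hom_ext (LinearMap.ext h))

theorem mul_gen_eq_zero {r : V ⊗[k] V} (hr : r ∈ R) :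
    LinearMap.mul' k (QuadAlg R) (TensorProduct.map (gen R) (gen R) r) = 0 := by
  have h : (TensorAlgebra.lift k (gen R)) = RingQuot.mkAlgHom k (QuadRel R) :=
    TensorAlgebra.hom_ext (by ext v; simp [gen])
  rw [← lift_tensorTwo, h]
  have := RingQuot.mkAlgHom_rel k (s := QuadRel R) ⟨r, hr, rfl, rfl⟩
  rw [this, map_zero]

theorem adjoin_range_gen : Algebra.adjoin k (Set.range (gen R)) = ⊤ := by
  have h : Set.range (gen R) =
      (RingQuot.mkAlgHom k (QuadRel R)) '' Set.range (TensorAlgebra.ι k (M := V)) := by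
    rw [← Set.range_comp]; rfl
  rw [h, Algebra.adjoin_image, TensorAlgebra.adjoin_range_ι, Algebra.map_top,
    AlgHom.range_eq_top]
  exact RingQuot.mkAlgHom_surjective k _

/-- The augmentation of `T(V)/(R)`. -/
def aug (R : Submodule k (V ⊗[k] V)) : QuadAlg R →ₐ[k] k :=
  lift 0 fun r _ => by simp [lift_tensorTwo]

theorem aug_gen (v : V) : aug R (gen R v) = 0 := by
  simp [aug]

theorem aug_eq_zero {m : ℕ} (hm : m ≠ 0) {a : QuadAlg R} (ha : a ∈ powGrading (gen R) m) :
    aug R a = 0 := by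
  obtain ⟨m, rfl⟩ := Nat.exists_eq_succ_of_ne_zero hm
  rw [powGrading, pow_succ'] at ha
  induction ha using Submodule.mul_induction_on' with
  | mem_mul_mem a ha b hb =>
    obtain ⟨v, rfl⟩ := ha
    rw [map_mul, aug_gen, zero_mul]
  | add a _ b _ ha hb => rw [map_add, ha, hb, add_zero]

end QuadAlg

instance powGrading.gradedMonoid {A : Type*} [Ring A] [Algebra k A] (f : V →ₗ[k] A) :
    SetLike.GradedMonoid (powGrading f) :=
  Submodule.nat_power_gradedMonoid (LinearMap.range f)

theorem mem_powGrading_one {A : Type*} [Ring A] [Algebra k A] (f : V →ₗ[k] A) (v : V) :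
    f v ∈ powGrading f 1 := by
  rw [powGrading, pow_one]; exact LinearMap.mem_range_self f v

namespace QuadAlg

open scoped DirectSum

variable (R : Submodule k (V ⊗[k] V))

/-- The canonical map from `V` to the graded pieces of `T(V)/(R)`. -/
def gradedGen : V →ₗ[k] ⨁ i : ℕ, powGrading (gen R) i :=
  DirectSum.lof k ℕ (fun i => powGrading (gen R) i) 1 ∘ₗ
    (gen R).codRestrict _ (mem_powGrading_one (gen R))

theorem gradedGen_apply (v : V) : gradedGen R v =
    DirectSum.of (fun i => powGrading (gen R) i) 1 ⟨gen R v, mem_powGrading_one (gen R) v⟩ := rfl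

theorem mul_gen_mem (r : V ⊗[k] V) :
    LinearMap.mul' k _ (TensorProduct.map (gen R) (gen R) r) ∈ powGrading (gen R) 2 := by
  induction r with
  | zero => simp
  | add a b ha hb => simpa only [map_add] using add_mem ha hb
  | tmul v w =>
    rw [powGrading, pow_two]
    exact Submodule.mul_mem_mul ⟨v, rfl⟩ ⟨w, rfl⟩

/-- The relations are homogeneous of degree two, so the map to the direct sum of the graded pieces
kills them and descends to the quotient. -/
theorem lift_gradedGen_tensorTwo (r : V ⊗[k] V) :
    TensorAlgebra.lift k (gradedGen R) (tensorTwo r) =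
      DirectSum.of (fun i => powGrading (gen R) i) 2
        ⟨LinearMap.mul' k _ (TensorProduct.map (gen R) (gen R) r), mul_gen_mem R r⟩ := by
  induction r with
  | zero =>
    simp only [map_zero]
    exact (map_zero (DirectSum.of (fun i => powGrading (gen R) i) 2)).symm
  | add a b ha hb =>
    simp only [map_add]
    rw [ha, hb, ← map_add]
    rfl
  | tmul v w =>
    rw [tensorTwo_tmul, map_mul, TensorAlgebra.lift_ι_apply, TensorAlgebra.lift_ι_apply,
      gradedGen_apply, gradedGen_apply, DirectSum.of_mul_of]
    rfl

/-- The decomposition map of `T(V)/(R)` into its graded pieces. -/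
def gradedLift : QuadAlg R →ₐ[k] ⨁ i : ℕ, powGrading (gen R) i :=
  lift (gradedGen R) fun r hr => by
    rw [lift_gradedGen_tensorTwo]
    exact (congrArg _ (Subtype.ext (mul_gen_eq_zero hr))).trans (map_zero _)

theorem gradedLift_eq (i : ℕ) (a : powGrading (gen R) i) :
    gradedLift R a = DirectSum.of (fun i => powGrading (gen R) i) i a := by
  obtain ⟨a, ha⟩ := a
  dsimp only
  induction ha using Submodule.pow_induction_on_left' with
  | algebraMap => rw [AlgHom.commutes, DirectSum.algebraMap_apply]; rfl
  | add _ _ _ _ _ ihx ihy => rw [map_add, ihx, ihy, ← map_add]; rfl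
  | mem_mul _ hm _ _ _ ih =>
    obtain ⟨_, rfl⟩ := hm
    rw [map_mul, ih, gradedLift, lift_gen, gradedGen_apply, DirectSum.of_mul_of]
    -- The product sits in degree `1 + i` and the target in degree `i + 1`, so the two are compared
    -- as dependent pairs.
    exact DirectSum.of_eq_of_gradedMonoid_eq (Sigma.subtype_ext (add_comm _ _) rfl)

instance gradedAlgebra : GradedAlgebra (powGrading (gen R)) :=
  GradedAlgebra.ofAlgHom _ (gradedLift R)
    (algHom_ext fun v => by
      rw [AlgHom.comp_apply, gradedLift, lift_gen, gradedGen_apply, DirectSum.coeAlgHom_of,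
        AlgHom.id_apply])
    (gradedLift_eq R)

theorem isConnectedGraded [Module.Finite k V] : IsConnectedGraded (powGrading (gen R)) where
  gradedMonoid := inferInstance
  isInternal := DirectSum.Decomposition.isInternal _
  connected := pow_zero _
  injective := by
    have h : Function.LeftInverse (aug R) (algebraMap k (QuadAlg R)) := fun c => by simp
    exact h.injective
  finite m := by
    rw [Module.Finite.iff_fg]
    have : (LinearMap.range (gen R)).FG := by
      rw [LinearMap.range_eq_map]; exact Module.Finite.fg_top.map _
    exact this.pow m

end QuadAlg

/-! ### Relations `x i ⊗ x j + c i j x j ⊗ x i` -/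

variable {n : ℕ} (x : Module.Basis (Fin n) k V)

theorem symRel_eq_extRel (q : Fin n → Fin n → k) : symRel x q = extRel x (-q) := by
  simp [symRel, extRel, sub_eq_add_neg]

theorem extRel_le_ker {W : Type*} [AddCommGroup W] [Module k W] {c : Fin n → Fin n → k}
    {f : V ⊗[k] V →ₗ[k] W}
    (hf : ∀ i j, f (x i ⊗ₜ x j) + c i j • f (x j ⊗ₜ x i) = 0) {r : V ⊗[k] V}
    (hr : r ∈ extRel x c) : f r = 0 := by
  have : extRel x c ≤ LinearMap.ker f := by
    refine Submodule.span_le.2 ?_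
    rintro _ ⟨p, rfl⟩
    simpa using hf p.1 p.2
  exact this hr

variable {x} in
/-- Algebra maps out of `T(V)/(x i ⊗ x j + c i j x j ⊗ x i)`. -/
def extRelLift {c : Fin n → Fin n → k} {B : Type*} [Ring B] [Algebra k B] (y : Fin n → B)
    (hy : ∀ i j, y i * y j + c i j • (y j * y i) = 0) : QuadAlg (extRel x c) →ₐ[k] B :=
  QuadAlg.lift (x.constr k y) fun r hr => by
    rw [lift_tensorTwo]
    refine extRel_le_ker x (f := LinearMap.mul' k B ∘ₗ
      TensorProduct.map (x.constr k y) (x.constr k y)) (fun i j => ?_) hr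
    simpa [Module.Basis.constr_basis] using hy i j

@[simp] theorem extRelLift_gen {c : Fin n → Fin n → k} {B : Type*} [Ring B] [Algebra k B]
    (y : Fin n → B) (hy : ∀ i j, y i * y j + c i j • (y j * y i) = 0) (i : Fin n) :
    extRelLift (x := x) y hy (QuadAlg.gen _ (x i)) = y i := by
  simp [extRelLift]

theorem extRel_gen_mul (c : Fin n → Fin n → k) (i j : Fin n) :
    QuadAlg.gen (extRel x c) (x i) * QuadAlg.gen _ (x j) +
      c i j • (QuadAlg.gen (extRel x c) (x j) * QuadAlg.gen _ (x i)) = 0 := by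
  have := QuadAlg.mul_gen_eq_zero (R := extRel x c)
    (r := x i ⊗ₜ x j + c i j • x j ⊗ₜ x i) (Submodule.subset_span ⟨(i, j), rfl⟩)
  simpa using this

variable {x} in
theorem quadAlg_hom_ext {R : Submodule k (V ⊗[k] V)} {B : Type*} [Ring B] [Algebra k B]
    {f g : QuadAlg R →ₐ[k] B}
    (h : ∀ i, f (QuadAlg.gen _ (x i)) = g (QuadAlg.gen _ (x i))) : f = g := by
  refine QuadAlg.algHom_ext fun v => ?_
  have : f.toLinearMap ∘ₗ QuadAlg.gen R = g.toLinearMap ∘ₗ QuadAlg.gen R := x.ext h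
  exact LinearMap.congr_fun this v

/-- A linear property of `1` that is stable under left multiplication by generators holds for all
elements. -/
theorem left_mul_induction {A : Type*} [Ring A] [Algebra k A] {f : V →ₗ[k] A}
    (hA : Algebra.adjoin k (Set.range f) = ⊤) {p : A → Prop} (h1 : p 1)
    (hadd : ∀ a b, p a → p b → p (a + b)) (hsmul : ∀ (r : k) a, p a → p (r • a))
    (hmul : ∀ i a, p a → p (f (x i) * a)) (a : A) : p a := by
  let P : Submodule k A :=
    { carrier := {a | p a}
      add_mem' := fun ha hb => hadd _ _ ha hb
      zero_mem' := by simpa using hsmul 0 1 h1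
      smul_mem' := hsmul }
  have hv : ∀ v, ∀ b ∈ P, f v * b ∈ P := by
    intro v b hb
    rw [← x.sum_repr v, map_sum, Finset.sum_mul]
    refine sum_mem fun i _ => ?_
    rw [map_smul, smul_mul_assoc]
    exact P.smul_mem _ (hmul i b hb)
  suffices h : ∀ b ∈ P, a * b ∈ P from mul_one a ▸ h 1 h1
  have ha : a ∈ Algebra.adjoin k (Set.range f) := hA ▸ Algebra.mem_top
  induction ha using Algebra.adjoin_induction with
  | mem a ha => obtain ⟨v, rfl⟩ := ha; exact hv v
  | algebraMap r => intro b hb; rw [← Algebra.smul_def]; exact P.smul_mem _ hb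
  | add a b _ _ ha hb => intro c hc; rw [add_mul]; exact add_mem (ha c hc) (hb c hc)
  | mul a b _ _ ha hb => intro c hc; rw [mul_assoc]; exact ha _ (hb c hc)

/-- An algebra with commuting generators is commutative. -/
theorem commute_of_generators {A : Type*} [Ring A] [Algebra k A] {f : V →ₗ[k] A}
    (hA : Algebra.adjoin k (Set.range f) = ⊤) (h : ∀ i j, Commute (f (x i)) (f (x j))) (a b : A) :
    Commute a b := by
  have h2 : ∀ i b, Commute (f (x i)) b := fun i =>
    left_mul_induction x hA (Commute.one_right _) (fun _ _ => Commute.add_right)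
      (fun r _ h => h.smul_right r) fun j _ hb => (h i j).mul_right hb
  exact left_mul_induction x hA (p := fun a => Commute a b) (Commute.one_left _)
    (fun _ _ => Commute.add_left) (fun r _ h => h.smul_left r)
    (fun j _ hb => (h2 j b).mul_left hb) a

end QuadAlg

/-! ### The symmetric and exterior algebras as quadratic algebras -/

section Classical

variable {n : ℕ} {V : Type*} [AddCommGroup V] [Module ℂ V] (x : Module.Basis (Fin n) ℂ V)

theorem exists_symmetricAlgebra_equiv_quadAlg :
    ∃ e : SymmetricAlgebra ℂ V ≃ₐ[ℂ] QuadAlg (symRel x fun _ _ => 1),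
      ∀ v, e (SymmetricAlgebra.ι ℂ V v) = QuadAlg.gen _ v := by
  rw [symRel_eq_extRel]
  set c : Fin n → Fin n → ℂ := -fun _ _ => 1
  have hcomm : ∀ a b : QuadAlg (extRel x c), a * b = b * a :=
    commute_of_generators x QuadAlg.adjoin_range_gen fun i j => by
      have := extRel_gen_mul x c i j
      rw [commute_iff_eq, ← sub_eq_zero]
      convert this using 1
      rw [sub_eq_add_neg]
      exact congrArg _ (neg_one_smul ℂ _).symm
  -- The universal property of `SymmetricAlgebra` requires a commutative target.
  let : CommRing (QuadAlg (extRel x c)) := { (inferInstance : Ring _) with mul_comm := hcomm }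
  let f : SymmetricAlgebra ℂ V →ₐ[ℂ] QuadAlg (extRel x c) :=
    SymmetricAlgebra.lift (QuadAlg.gen (extRel x c))
  let g : QuadAlg (extRel x c) →ₐ[ℂ] SymmetricAlgebra ℂ V :=
    extRelLift (fun i => SymmetricAlgebra.ι ℂ V (x i)) fun i j => by
      simp [c, mul_comm]
  refine ⟨AlgEquiv.ofAlgHom f g ?_ ?_, fun v => SymmetricAlgebra.lift_ι_apply _ _⟩
  · refine quadAlg_hom_ext (x := x) fun i => ?_
    simp [f, g]
  · refine SymmetricAlgebra.algHom_ext (x.ext fun i => ?_)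
    simp [f, g]

/-- The relations concern basis vectors only. The bilinear map `(v, w) ↦ v w + w v` vanishes on the
basis, hence everywhere, and its diagonal is twice the square. -/
theorem extRel_one_gen_sq (v : V) :
    QuadAlg.gen (extRel x fun _ _ => 1) v * QuadAlg.gen (extRel x fun _ _ => 1) v = 0 := by
  set Q := QuadAlg (extRel x fun _ _ => 1)
  let G : V →ₗ[ℂ] Q := QuadAlg.gen (extRel x fun _ _ => 1)
  let B : V →ₗ[ℂ] V →ₗ[ℂ] Q := (LinearMap.mul ℂ Q).compl₁₂ G G
  have h : B + B.flip = 0 := x.ext fun i => x.ext fun j => by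
    simpa [B, G] using extRel_gen_mul x (fun _ _ => (1 : ℂ)) i j
  have h2 : B v v + B v v = 0 := by
    have := LinearMap.congr_fun (LinearMap.congr_fun h v) v
    simpa using this
  rw [← two_smul ℂ] at h2
  exact (smul_eq_zero.1 h2).resolve_left two_ne_zero

theorem exists_exteriorAlgebra_equiv_quadAlg :
    ∃ e : ExteriorAlgebra ℂ V ≃ₐ[ℂ] QuadAlg (extRel x fun _ _ => 1),
      ∀ v, e (ExteriorAlgebra.ι ℂ v) = QuadAlg.gen _ v := by
  let f : ExteriorAlgebra ℂ V →ₐ[ℂ] QuadAlg (extRel x fun _ _ => 1) :=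
    ExteriorAlgebra.lift ℂ ⟨QuadAlg.gen _, extRel_one_gen_sq x⟩
  let g : QuadAlg (extRel x fun _ _ => 1) →ₐ[ℂ] ExteriorAlgebra ℂ V :=
    extRelLift (fun i => ExteriorAlgebra.ι ℂ (x i)) fun i j => by
      rw [one_smul]; exact ExteriorAlgebra.ι_add_mul_swap _ _
  refine ⟨AlgEquiv.ofAlgHom f g ?_ ?_, fun v => ExteriorAlgebra.lift_ι_apply _ _ _ _⟩
  · refine quadAlg_hom_ext (x := x) fun i => ?_
    simp [f, g]
  · refine ExteriorAlgebra.hom_ext (x.ext fun i => ?_)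
    simp [f, g]

end Classical

/-! ### The action of the cocycle on weight vectors -/

section CocycleAction

variable {n : ℕ}

/-- The product of the `t j` for `j < i`. -/
def tBelow (i : Fin n) : CTwoPow n := fun j => if j < i then -1 else 1

/-- The product of the `t j` for `i < j`. -/
def tAbove (i : Fin n) : CTwoPow n := fun j => if i < j then -1 else 1

theorem cTwoPow_mul_self (s : CTwoPow n) : s * s = 1 := by
  funext j
  exact Int.units_mul_self (s j)

theorem prod_ite_t (S : Finset (Fin n)) : ∏ j ∈ S, t j = fun j => if j ∈ S then -1 else 1 := by
  funext j
  rw [Finset.prod_apply]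
  simp [t, Pi.mulSingle_apply, Finset.prod_ite_eq]

/-- The product is indexed by the same pairs as `muElem`, so that each factor of `mu` can be matched
with one factor here. -/
theorem tBelow_eq_prod (i : Fin n) :
    tBelow i = ∏ p : Fin n × Fin n with p.2 < p.1, if p.1 = i then t p.2 else 1 := by
  have h : tBelow i = ∏ j ∈ Finset.univ.filter (· < i), t j := by
    rw [prod_ite_t]; funext j; simp [tBelow]
  rw [h, ← Finset.prod_filter, Finset.filter_filter]
  refine Finset.prod_bij (fun j _ => (i, j)) (by simp) (by simp) ?_ (by simp)
  rintro ⟨a, b⟩ h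
  simp only [Finset.mem_filter, Finset.mem_univ, true_and] at h
  exact ⟨b, by simpa [h.2] using h.1, by rw [h.2]⟩

theorem tAbove_eq_prod (j : Fin n) :
    tAbove j = ∏ p : Fin n × Fin n with p.2 < p.1, if p.2 = j then t p.1 else 1 := by
  have h : tAbove j = ∏ i ∈ Finset.univ.filter (j < ·), t i := by
    rw [prod_ite_t]; funext j; simp [tAbove]
  rw [h, ← Finset.prod_filter, Finset.filter_filter]
  refine Finset.prod_bij (fun i _ => (i, j)) (by simp) (by simp) ?_ (by simp)
  rintro ⟨a, b⟩ h
  simp only [Finset.mem_filter, Finset.mem_univ, true_and] at h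
  exact ⟨a, by simpa [h.2] using h.1, by rw [h.2]⟩

variable {M N : Type*} [AddCommGroup M] [Module ℂ M] [AddCommGroup N] [Module ℂ N]
  (ρ : GroupAlg n →ₐ[ℂ] Module.End ℂ M) (σ : GroupAlg n →ₐ[ℂ] Module.End ℂ N)

/-- If `t a` acts on `v` by `ε = ±1`, the factor acts on `w` by `(1 + ε + t b - ε t b) / 2`, which
is `1` for `ε = 1` and `t b` for `ε = -1`. -/
theorem muFactor_tmul_of_left {i : Fin n} {v : M}
    (hv : ∀ j, ρ (tH j) v = (if j = i then (-1 : ℂ) else 1) • v) (a b : Fin n) (w : N) :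
    tensorAction ρ σ (muFactor a b) (v ⊗ₜ w) =
      v ⊗ₜ σ (MonoidAlgebra.of ℂ _ (if a = i then t b else 1)) w := by
  have h2 : (1 / 2 : ℂ) • (v ⊗ₜ[ℂ] w + v ⊗ₜ w) = v ⊗ₜ w := by
    rw [← two_smul ℂ, smul_smul]; norm_num
  have h3 : (1 / 2 : ℂ) • (v ⊗ₜ[ℂ] σ (tH b) w + v ⊗ₜ σ (tH b) w) = v ⊗ₜ σ (tH b) w := by
    rw [← two_smul ℂ, smul_smul]; norm_num
  simp only [muFactor, map_smul, map_add, map_sub, LinearMap.smul_apply, LinearMap.add_apply,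
    LinearMap.sub_apply, tensorAction_tmul_tmul, map_one, Module.End.one_apply, hv]
  split_ifs with h
  · rw [neg_smul, one_smul, TensorProduct.neg_tmul, TensorProduct.neg_tmul, sub_neg_eq_add,
      add_neg_cancel, zero_add]
    exact h3
  · rw [one_smul, add_sub_cancel_right, map_one, map_one, Module.End.one_apply]
    exact h2

theorem muFactor_tmul_of_right {j : Fin n} {w : N}
    (hw : ∀ i, σ (tH i) w = (if i = j then (-1 : ℂ) else 1) • w) (a b : Fin n) (v : M) :
    tensorAction ρ σ (muFactor a b) (v ⊗ₜ w) =
      ρ (MonoidAlgebra.of ℂ _ (if b = j then t a else 1)) v ⊗ₜ w := by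
  have h2 : (1 / 2 : ℂ) • (v ⊗ₜ[ℂ] w + v ⊗ₜ w) = v ⊗ₜ w := by
    rw [← two_smul ℂ, smul_smul]; norm_num
  have h3 : (1 / 2 : ℂ) • (ρ (tH a) v ⊗ₜ[ℂ] w + ρ (tH a) v ⊗ₜ w) = ρ (tH a) v ⊗ₜ w := by
    rw [← two_smul ℂ, smul_smul]; norm_num
  simp only [muFactor, map_smul, map_add, map_sub, LinearMap.smul_apply, LinearMap.add_apply,
    LinearMap.sub_apply, tensorAction_tmul_tmul, map_one, Module.End.one_apply, hw]
  split_ifs with h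
  · rw [neg_smul, one_smul, TensorProduct.tmul_neg, TensorProduct.tmul_neg, sub_neg_eq_add,
      add_right_comm _ _ (-_), add_neg_cancel, zero_add]
    exact h3
  · rw [one_smul, add_right_comm, add_sub_cancel_right, map_one, map_one, Module.End.one_apply]
    exact h2

theorem mu_tmul_of_left {i : Fin n} {v : M}
    (hv : ∀ j, ρ (tH j) v = (if j = i then (-1 : ℂ) else 1) • v) (w : N) :
    tensorAction ρ σ (mu n).val (v ⊗ₜ w) = v ⊗ₜ σ (MonoidAlgebra.of ℂ _ (tBelow i)) w := by
  rw [tBelow_eq_prod]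
  change tensorAction ρ σ (muElem n) _ = _
  rw [muElem]
  -- The index set is generalized to an arbitrary finite set of pairs, and both products grow by one
  -- factor at a time.
  induction (Finset.univ.filter fun p : Fin n × Fin n => p.2 < p.1) using Finset.induction_on with
  | empty => simp only [Finset.prod_empty, map_one, Module.End.one_apply]
  | insert p S hp ih =>
    rw [Finset.prod_insert hp, Finset.prod_insert hp, map_mul, Module.End.mul_apply, ih,
      muFactor_tmul_of_left ρ σ hv, map_mul, map_mul, Module.End.mul_apply]

theorem mu_tmul_of_right {j : Fin n} {w : N}
    (hw : ∀ i, σ (tH i) w = (if i = j then (-1 : ℂ) else 1) • w) (v : M) :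
    tensorAction ρ σ (mu n).val (v ⊗ₜ w) = ρ (MonoidAlgebra.of ℂ _ (tAbove j)) v ⊗ₜ w := by
  rw [tAbove_eq_prod]
  change tensorAction ρ σ (muElem n) _ = _
  rw [muElem]
  induction (Finset.univ.filter fun p : Fin n × Fin n => p.2 < p.1) using Finset.induction_on with
  | empty => simp only [Finset.prod_empty, map_one, Module.End.one_apply]
  | insert p S hp ih =>
    rw [Finset.prod_insert hp, Finset.prod_insert hp, map_mul, Module.End.mul_apply, ih,
      muFactor_tmul_of_right ρ σ hw, map_mul, map_mul, Module.End.mul_apply]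

end CocycleAction

/-! ### Twisting the relations -/

section Relations

variable {n : ℕ} {V : Type*} [AddCommGroup V] [Module ℂ V] (x : Module.Basis (Fin n) ℂ V)

theorem coe_t_apply (i j : Fin n) :
    (((t i : CTwoPow n) j : ℤ) : ℂ) = if i = j then -1 else 1 := by
  by_cases h : i = j
  · subst h; simp [t]
  · simp [t, h, Ne.symm h]

theorem vAction_of (s : CTwoPow n) (j : Fin n) :
    vAction x (MonoidAlgebra.of ℂ _ s) (x j) = ((s j : ℤ) : ℂ) • x j := by
  rw [vAction, MonoidAlgebra.lift_of]
  simp [diagAction]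

theorem mu_basis_tmul (i j : Fin n) :
    tensorAction (vAction x) (vAction x) (mu n).val (x i ⊗ₜ x j) =
      (if j < i then (-1 : ℂ) else 1) • x i ⊗ₜ x j := by
  rw [mu_tmul_of_left (i := i)]
  · rw [vAction_of, TensorProduct.tmul_smul, tBelow]
    split_ifs <;> simp
  · intro k
    rw [tH, vAction_of, coe_t_apply]

/-- For `i ≠ j` exactly one of `x i ⊗ x j` and `x j ⊗ x i` changes sign, for `i = j` neither does.
The generator at `(i, j)` therefore goes to plus or minus the generator for `c * negOne n`, and the
sign does not affect the span. -/
theorem map_mu_extRel (c : Fin n → Fin n → ℂ) :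
    (extRel x c).map (tensorAction (vAction x) (vAction x) (mu n).val) =
      extRel x (c * negOne n) := by
  rw [extRel, Submodule.map_span, ← Set.range_comp, extRel]
  have h : ∀ p : Fin n × Fin n,
      tensorAction (vAction x) (vAction x) (mu n).val
        (x p.1 ⊗ₜ[ℂ] x p.2 + c p.1 p.2 • x p.2 ⊗ₜ[ℂ] x p.1) =
      (if p.2 < p.1 then (-1 : ℂ) else 1) •
        (x p.1 ⊗ₜ[ℂ] x p.2 + (c * negOne n) p.1 p.2 • x p.2 ⊗ₜ[ℂ] x p.1) := by
    rintro ⟨i, j⟩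
    simp only [map_add, map_smul, mu_basis_tmul, Pi.mul_apply, negOne, smul_add, smul_smul]
    congr 2
    rcases lt_trichotomy i j with h | h | h
    · simp [h, h.ne, h.not_gt]
    · simp [h]
    · simp [h, h.ne', h.not_gt]
  refine le_antisymm (Submodule.span_le.2 ?_) (Submodule.span_le.2 ?_)
  · rintro _ ⟨p, rfl⟩
    rw [Function.comp_apply, h]
    exact Submodule.smul_mem _ _ (Submodule.subset_span ⟨p, rfl⟩)
  · rintro _ ⟨p, rfl⟩
    have := Submodule.smul_mem _ (if p.2 < p.1 then (-1 : ℂ) else 1) (Submodule.subset_span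
      (R := ℂ) (Set.mem_range_self (f := (tensorAction (vAction x) (vAction x) (mu n).val) ∘
        fun p : Fin n × Fin n => x p.1 ⊗ₜ[ℂ] x p.2 + c p.1 p.2 • x p.2 ⊗ₜ[ℂ] x p.1) p))
    rw [Function.comp_apply, h, smul_smul] at this
    convert this using 1
    split_ifs <;> simp

theorem extRel_negOne : extRel x (negOne n) =
    Submodule.span ℂ ({r | ∃ i, r = x i ⊗ₜ[ℂ] x i} ∪
      {r | ∃ i j, i ≠ j ∧ r = x i ⊗ₜ[ℂ] x j - x j ⊗ₜ[ℂ] x i}) := by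
  refine le_antisymm (Submodule.span_le.2 ?_) (Submodule.span_le.2 ?_)
  · rintro _ ⟨⟨i, j⟩, rfl⟩
    by_cases h : i = j
    · subst h
      have := Submodule.subset_span (R := ℂ) (s := {r | ∃ i, r = x i ⊗ₜ[ℂ] x i} ∪
        {r | ∃ i j, i ≠ j ∧ r = x i ⊗ₜ[ℂ] x j - x j ⊗ₜ[ℂ] x i}) (Or.inl ⟨i, rfl⟩)
      simpa [negOne] using add_mem this this
    · refine Submodule.subset_span (Or.inr ⟨i, j, h, ?_⟩)
      simp [negOne, h, sub_eq_add_neg]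
  · rintro _ (⟨i, rfl⟩ | ⟨i, j, h, rfl⟩)
    · have := Submodule.smul_mem _ (1 / 2 : ℂ) (Submodule.subset_span (R := ℂ)
        (Set.mem_range_self (f := fun p : Fin n × Fin n =>
          x p.1 ⊗ₜ[ℂ] x p.2 + negOne n p.1 p.2 • x p.2 ⊗ₜ[ℂ] x p.1) (i, i)))
      have h2 : (1 / 2 : ℂ) • (x i ⊗ₜ[ℂ] x i + negOne n i i • x i ⊗ₜ[ℂ] x i) = x i ⊗ₜ x i := by
        rw [negOne, if_pos rfl, one_smul, ← two_smul ℂ, smul_smul]; norm_num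
      rwa [h2] at this
    · refine Submodule.subset_span ⟨(i, j), ?_⟩
      simp [negOne, h, sub_eq_add_neg]

end Relations

/-! ### The twisted product with a generator -/

section Twist

variable {n : ℕ} {V : Type*} [AddCommGroup V] [Module ℂ V] (x : Module.Basis (Fin n) ℂ V)
  {A : Type*} [Ring A] [Algebra ℂ A] {φ : CTwoPow n →* (A →ₐ[ℂ] A)} {ι : V →ₗ[ℂ] A}

theorem algAction_of (φ : CTwoPow n →* (A →ₐ[ℂ] A)) (s : CTwoPow n) (a : A) :
    algAction φ (MonoidAlgebra.of ℂ _ s) a = φ s a := by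
  rw [algAction, MonoidAlgebra.lift_of]
  rfl

/-- The twist of an algebra on which `T` acts by algebra endomorphisms. -/
abbrev AlgTwist (φ : CTwoPow n →* (A →ₐ[ℂ] A)) : Type _ :=
  DrinfeldTwist (algAction φ) (algAction_isModuleAlgebra φ) (mu n) (mu_isCounitalTwoCocycle n)

variable (hφ : ∀ s j, φ s (ι (x j)) = ((s j : ℤ) : ℂ) • ι (x j))
include hφ

theorem algAction_tH_gen (i j : Fin n) :
    algAction φ (tH i) (ι (x j)) = (if i = j then (-1 : ℂ) else 1) • ι (x j) := by
  rw [tH, algAction_of, hφ, coe_t_apply]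

/-- Since `x i` is a weight vector and `mu` is its own inverse, the twist amounts to applying
`tBelow i` to the other factor. Explicit twisted products are computed below through this formula
and its mirror image `of_mul_gen`. -/
theorem of_gen_mul (i : Fin n) (a : A) :
    (DrinfeldTwist.of (ι (x i)) * DrinfeldTwist.of a : AlgTwist φ) =
      DrinfeldTwist.of (ι (x i) * φ (tBelow i) a) := by
  rw [DrinfeldTwist.mul_def, LinearEquiv.symm_apply_apply, LinearEquiv.symm_apply_apply, twistMul,
    LinearMap.comp_apply, show ((mu n)⁻¹ : (GroupAlg n ⊗[ℂ] GroupAlg n)ˣ) = mu n from rfl]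
  have := mu_tmul_of_left (algAction φ) (algAction φ)
    (fun j => algAction_tH_gen x hφ j i) a
  rw [this, algAction_of, LinearMap.mul'_apply]

theorem of_mul_gen (j : Fin n) (a : A) :
    (DrinfeldTwist.of a * DrinfeldTwist.of (ι (x j)) : AlgTwist φ) =
      DrinfeldTwist.of (φ (tAbove j) a * ι (x j)) := by
  rw [DrinfeldTwist.mul_def, LinearEquiv.symm_apply_apply, LinearEquiv.symm_apply_apply, twistMul,
    LinearMap.comp_apply, show ((mu n)⁻¹ : (GroupAlg n ⊗[ℂ] GroupAlg n)ˣ) = mu n from rfl]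
  have := mu_tmul_of_right (algAction φ) (algAction φ)
    (fun i => algAction_tH_gen x hφ i j) a
  rw [this, algAction_of, LinearMap.mul'_apply]

theorem map_mem_powGrading (s : CTwoPow n) {m : ℕ} {a : A} (ha : a ∈ powGrading ι m) :
    φ s a ∈ powGrading ι m := by
  have h : (LinearMap.range ι).map (φ s).toLinearMap ≤ LinearMap.range ι := by
    rw [← LinearMap.range_comp]
    have h2 : (φ s).toLinearMap ∘ₗ ι = ι ∘ₗ diagAction x s := x.ext fun j => by
      simp [diagAction, hφ]
    rw [h2]
    exact LinearMap.range_comp_le_range _ _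
  have h2 : φ s a ∈ (powGrading ι m).map (φ s).toLinearMap := ⟨a, ha, rfl⟩
  rw [powGrading, Submodule.map_pow] at h2
  exact pow_le_pow_left' h m h2

theorem algAction_mem_powGrading (h : GroupAlg n) {m : ℕ} {a : A} (ha : a ∈ powGrading ι m) :
    algAction φ h a ∈ powGrading ι m := by
  induction h using MonoidAlgebra.induction_on with
  | of s => rw [algAction_of]; exact map_mem_powGrading x hφ s ha
  | add f g hf hg => rw [map_add]; exact add_mem hf hg
  | smul r f hf => rw [map_smul]; exact Submodule.smul_mem _ _ hf

/-- The left side uses untwisted products of generators, the right side twisted ones. They span the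
same space because the two products by `x i` differ by `tBelow i`, an involution that preserves each
degree. -/
theorem map_of_powGrading (m : ℕ) :
    (powGrading ι m).map (DrinfeldTwist.of : A ≃ₗ[ℂ] AlgTwist φ).toLinearMap =
      powGrading ((DrinfeldTwist.of : A ≃ₗ[ℂ] AlgTwist φ).toLinearMap ∘ₗ ι) m := by
  induction m with
  | zero =>
    rw [powGrading, powGrading, pow_zero, pow_zero, Submodule.one_eq_span, Submodule.one_eq_span,
      Submodule.map_span, Set.image_singleton]
    rfl
  | succ m ih =>
    have hι : LinearMap.range ι = Submodule.span ℂ (Set.range fun i => ι (x i)) := by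
      rw [LinearMap.range_eq_map, ← x.span_eq, Submodule.map_span, ← Set.range_comp]; rfl
    have hι' : LinearMap.range ((DrinfeldTwist.of : A ≃ₗ[ℂ] AlgTwist φ).toLinearMap ∘ₗ ι) =
        Submodule.span ℂ (Set.range fun i => (DrinfeldTwist.of (ι (x i)) : AlgTwist φ)) := by
      rw [LinearMap.range_eq_map, ← x.span_eq, Submodule.map_span, ← Set.range_comp]; rfl
    have hs : ∀ i, (φ (tBelow i)) ∘ (φ (tBelow i)) = id := fun i => by
      funext a
      rw [Function.comp_apply, ← AlgHom.mul_apply, ← map_mul, cTwoPow_mul_self, map_one]; rfl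
    have hP : ∀ i, ∀ a ∈ powGrading ι m, φ (tBelow i) a ∈ powGrading ι m := fun i _ ha =>
      map_mem_powGrading x hφ (tBelow i) ha
    simp only [powGrading] at ih hP ⊢
    rw [pow_succ', pow_succ', ← ih]
    -- Hiding the power keeps `hι` from rewriting the range inside it; only stability under each
    -- `tBelow i` is needed of `P`.
    generalize LinearMap.range ι ^ m = P at hP
    rw [hι, hι']
    refine le_antisymm (Submodule.map_le_iff_le_comap.2 (Submodule.mul_le.2 ?_))
      (Submodule.mul_le.2 ?_)
    · intro v hv a ha
      induction hv using Submodule.span_induction with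
      | mem v hv =>
        obtain ⟨i, rfl⟩ := hv
        have h1 : ι (x i) * a = ι (x i) * φ (tBelow i) (φ (tBelow i) a) := by
          rw [show φ (tBelow i) (φ (tBelow i) a) = a from congrFun (hs i) a]
        rw [Submodule.mem_comap, h1]
        change DrinfeldTwist.of _ ∈ _
        rw [← of_gen_mul x hφ]
        exact Submodule.mul_mem_mul (Submodule.subset_span ⟨i, rfl⟩)
          ⟨_, hP i a ha, rfl⟩
      | zero => rw [zero_mul]; exact zero_mem _
      | add v w _ _ hv hw => rw [add_mul]; exact add_mem hv hw
      | smul r v _ hv => rw [smul_mul_assoc]; exact Submodule.smul_mem _ _ hv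
    · rintro v hv _ ⟨a, ha, rfl⟩
      induction hv using Submodule.span_induction with
      | mem v hv =>
        obtain ⟨i, rfl⟩ := hv
        change DrinfeldTwist.of _ * DrinfeldTwist.of _ ∈ _
        rw [of_gen_mul x hφ]
        exact ⟨_, Submodule.mul_mem_mul (Submodule.subset_span ⟨i, rfl⟩)
          (hP i a ha), rfl⟩
      | zero => rw [zero_mul]; exact zero_mem _
      | add v w _ _ hv hw => rw [add_mul]; exact add_mem hv hw
      | smul r v _ hv => rw [smul_mul_assoc]; exact Submodule.smul_mem _ _ hv

end Twist

/-! ### The twist of a quadratic algebra is the quadratic algebra of the twisted relations -/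

section TwistEquiv

variable {n : ℕ} {V : Type*} [AddCommGroup V] [Module ℂ V] (x : Module.Basis (Fin n) ℂ V)

/-- The action of `T` on `T(V)/(x i ⊗ x j + c i j x j ⊗ x i)`. -/
def quadAction (c : Fin n → Fin n → ℂ) (s : CTwoPow n) :
    QuadAlg (extRel x c) →ₐ[ℂ] QuadAlg (extRel x c) :=
  extRelLift (fun j => ((s j : ℤ) : ℂ) • QuadAlg.gen (extRel x c) (x j)) fun i j => by
    -- Each relation is a weight vector: `s` multiplies both of its terms by `s i * s j`.
    have h := congrArg (fun a => (((s i : ℤ) : ℂ) * ((s j : ℤ) : ℂ)) • a) (extRel_gen_mul x c i j)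
    simp only [smul_add, smul_zero] at h
    rw [smul_mul_smul_comm, smul_mul_smul_comm, smul_comm (c i j)]
    rwa [mul_comm ((s j : ℤ) : ℂ)]

@[simp] theorem quadAction_gen (c : Fin n → Fin n → ℂ) (s : CTwoPow n) (j : Fin n) :
    quadAction x c s (QuadAlg.gen _ (x j)) = ((s j : ℤ) : ℂ) • QuadAlg.gen _ (x j) := by
  rw [quadAction, extRelLift_gen]

theorem quadAction_mul (c : Fin n → Fin n → ℂ) (s s' : CTwoPow n) (q : QuadAlg (extRel x c)) :
    quadAction x c s (quadAction x c s' q) = quadAction x c (s * s') q := by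
  have h : (quadAction x c s).comp (quadAction x c s') = quadAction x c (s * s') :=
    quadAlg_hom_ext (x := x) fun i => by simp [smul_smul, mul_comm]
  exact AlgHom.congr_fun h q

/-- Left multiplication by a generator composed with the action of `tBelow`. -/
def untwistMul (c : Fin n → Fin n → ℂ) (i : Fin n) : Module.End ℂ (QuadAlg (extRel x c)) :=
  LinearMap.mulLeft ℂ (QuadAlg.gen _ (x i)) ∘ₗ (quadAction x c (tBelow i)).toLinearMap

theorem untwistMul_apply (c : Fin n → Fin n → ℂ) (i : Fin n) (q : QuadAlg (extRel x c)) :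
    untwistMul x c i q = QuadAlg.gen _ (x i) * quadAction x c (tBelow i) q := rfl

/-- Twisting a second time undoes the sign: on the algebra with relations `c * negOne n`, these
operators satisfy the relations with `c`. Hence the untwisted algebra acts on the twisted one. -/
theorem untwistMul_relation (c : Fin n → Fin n → ℂ) (i j : Fin n) :
    untwistMul x (c * negOne n) i * untwistMul x (c * negOne n) j +
      c i j • (untwistMul x (c * negOne n) j * untwistMul x (c * negOne n) i) = 0 := by
  refine LinearMap.ext fun q => ?_
  have h := extRel_gen_mul x (c * negOne n) i j
  simp only [LinearMap.add_apply, Module.End.mul_apply, LinearMap.smul_apply, untwistMul_apply,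
    map_mul, quadAction_gen, quadAction_mul, LinearMap.zero_apply, mul_comm (tBelow j) (tBelow i)]
  set r := quadAction x (c * negOne n) (tBelow i * tBelow j) q
  set X := QuadAlg.gen (extRel x (c * negOne n)) (x i)
  set Y := QuadAlg.gen (extRel x (c * negOne n)) (x j)
  suffices h2 : ∃ d : ℂ, d • ((X * Y + (c * negOne n) i j • (Y * X)) * r) =
      X * ((((tBelow i j : ℤˣ) : ℤ) : ℂ) • Y * r) +
        c i j • (Y * ((((tBelow j i : ℤˣ) : ℤ) : ℂ) • X * r)) by
    obtain ⟨d, hd⟩ := h2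
    rw [← hd, h, zero_mul, smul_zero]
  -- This is the sign that `X * Y` acquires when `tBelow i` passes `x j`. The term `Y * X` acquires
  -- `tBelow j i`, and the two signs differ exactly when `i ≠ j`.
  refine ⟨(((tBelow i j : ℤˣ) : ℤ) : ℂ), ?_⟩
  simp only [add_mul, smul_add, smul_mul_assoc, mul_smul_comm, smul_smul, mul_assoc]
  congr 2
  simp only [Pi.mul_apply, negOne, tBelow]
  rcases lt_trichotomy i j with h | h | h
  · simp [h, h.ne, h.not_gt]
  · simp [h]
  · simp [h, h.ne', h.not_gt]

variable {A : Type*} [Ring A] [Algebra ℂ A] {φ : CTwoPow n →* (A →ₐ[ℂ] A)} {ι : V →ₗ[ℂ] A}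

/-- The map `f` into the twist comes from the relations. Its inverse `g` is the orbit map of `1`
under the action `Γ` of `A`, so neither a basis nor a dimension count is needed. -/
theorem exists_twist_equiv
    (hφ : ∀ s j, φ s (ι (x j)) = ((s j : ℤ) : ℂ) • ι (x j))
    (c : Fin n → Fin n → ℂ) (e₀ : A ≃ₐ[ℂ] QuadAlg (extRel x c))
    (he₀ : ∀ v, e₀ (ι v) = QuadAlg.gen _ v) :
    ∃ e : AlgTwist φ ≃ₐ[ℂ] QuadAlg (extRel x (c * negOne n)),
      (∀ v, e (DrinfeldTwist.of (ι v)) = QuadAlg.gen _ v) ∧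
      ∀ m, (DrinfeldTwist.grading _ (algAction_isModuleAlgebra φ) _ (mu_isCounitalTwoCocycle n)
        (powGrading ι) m).map e.toLinearMap = powGrading (QuadAlg.gen (extRel x (c * negOne n))) m := by
  have hι : Algebra.adjoin ℂ (Set.range ι) = ⊤ := by
    have h : Set.range ι = e₀.symm.toAlgHom '' Set.range (QuadAlg.gen (extRel x c)) := by
      rw [← Set.range_comp]
      congr 1
      funext v
      simp [← he₀]
    rw [h, Algebra.adjoin_image, QuadAlg.adjoin_range_gen, Algebra.map_top,
      AlgHom.range_eq_top]
    exact e₀.symm.surjective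
  have hrel : ∀ i j, ι (x i) * ι (x j) + c i j • (ι (x j) * ι (x i)) = 0 := fun i j => by
    apply e₀.injective
    simpa [he₀] using extRel_gen_mul x c i j
  set c' := c * negOne n with hc'
  let f : QuadAlg (extRel x c') →ₐ[ℂ] AlgTwist φ :=
    extRelLift (fun i => DrinfeldTwist.of (ι (x i))) fun i j => by
      rw [of_gen_mul x hφ, of_gen_mul x hφ, hφ, hφ, ← map_smul DrinfeldTwist.of,
        ← map_add DrinfeldTwist.of]
      refine (congrArg _ ?_).trans (map_zero _)
      rw [mul_smul_comm, mul_smul_comm, smul_smul]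
      have h := congrArg (fun a => (((tBelow i j : ℤˣ) : ℤ) : ℂ) • a) (hrel i j)
      simp only [smul_add, smul_zero, smul_smul] at h
      rw [← h]
      congr 2
      simp only [hc', Pi.mul_apply, negOne, tBelow]
      rcases lt_trichotomy i j with h | h | h
      · simp [h, h.ne, h.not_gt]
      · simp [h]
      · simp [h, h.ne', h.not_gt]
  let Γ : A →ₐ[ℂ] Module.End ℂ (QuadAlg (extRel x c')) :=
    (extRelLift (untwistMul x c') (untwistMul_relation x c)).comp e₀.toAlgHom
  have hΓ : ∀ i, Γ (ι (x i)) = untwistMul x c' i := fun i => by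
    simp [Γ, he₀]
  let g : A →ₗ[ℂ] QuadAlg (extRel x c') := LinearMap.applyₗ 1 ∘ₗ Γ.toLinearMap
  have hg : ∀ a, g a = Γ a 1 := fun a => rfl
  have hg1 : g 1 = 1 := by rw [hg, map_one Γ]; rfl
  -- The action `Γ` is `T`-equivariant; this moves `tBelow i` inside `g` in `hgmul`.
  have hΓφ : ∀ s a, ∀ q, quadAction x c' s (Γ a q) = Γ (φ s a) (quadAction x c' s q) := by
    intro s
    refine left_mul_induction x hι ?_ ?_ ?_ ?_
    · intro q; rw [map_one, map_one, map_one, Module.End.one_apply, Module.End.one_apply]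
    · intro a b ha hb q
      rw [map_add, map_add, map_add, LinearMap.add_apply, LinearMap.add_apply, map_add, ha, hb]
    · intro r a ha q
      rw [map_smul, map_smul, map_smul, LinearMap.smul_apply, LinearMap.smul_apply, map_smul, ha]
    · intro i a ha q
      rw [map_mul, map_mul, map_mul, hφ, map_smul, hΓ]
      simp only [Module.End.mul_apply, LinearMap.smul_apply, untwistMul_apply, map_mul,
        quadAction_gen, quadAction_mul, ← ha, mul_comm s, smul_mul_assoc]
  have hgmul : ∀ i a, g (ι (x i) * a) = QuadAlg.gen _ (x i) * g (φ (tBelow i) a) := by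
    intro i a
    rw [hg, map_mul, Module.End.mul_apply, hΓ, untwistMul_apply, hΓφ, map_one, hg]
  have hff : ∀ i a, φ (tBelow i) (φ (tBelow i) a) = a := fun i a => by
    rw [← AlgHom.mul_apply, ← map_mul, cTwoPow_mul_self, map_one]; rfl
  have hfgen : ∀ i, f (QuadAlg.gen _ (x i)) = DrinfeldTwist.of (ι (x i)) := fun i =>
    extRelLift_gen x _ _ i
  have hgf : ∀ q, g (DrinfeldTwist.of.symm (f q)) = q := by
    refine left_mul_induction x QuadAlg.adjoin_range_gen ?_ ?_ ?_ ?_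
    · rw [map_one]; exact hg1
    · intro a b ha hb
      rw [map_add, map_add, map_add, ha, hb]
    · intro r a ha
      rw [map_smul, map_smul, map_smul, ha]
    · intro i a ha
      have h1 : f (QuadAlg.gen (extRel x c') (x i) * a) = DrinfeldTwist.of
          (ι (x i) * φ (tBelow i) (DrinfeldTwist.of.symm (f a))) := by
        rw [← of_gen_mul x hφ, map_mul, LinearEquiv.apply_symm_apply, hfgen]
      rw [h1, LinearEquiv.symm_apply_apply, hgmul, hff, ha]
  -- The recursion `hgmul` replaces `a` by its image under `tBelow i`, so the induction must cover
  -- all translates of `a` at once.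
  have hfg : ∀ a, ∀ s, f (g (φ s a)) = DrinfeldTwist.of (φ s a) := by
    refine left_mul_induction x hι ?_ ?_ ?_ ?_
    · intro s
      rw [map_one, hg1, map_one]; rfl
    · intro a b ha hb s
      rw [map_add, map_add, map_add, map_add, ha, hb]
    · intro r a ha s
      rw [map_smul, map_smul, map_smul, map_smul, ha]
    · intro i a ha s
      rw [map_mul (φ s), hφ, smul_mul_assoc, map_smul, map_smul, map_smul, hgmul, map_mul f]
      congr 1
      rw [← AlgHom.mul_apply, ← map_mul φ, ha, hfgen, of_gen_mul x hφ, ← AlgHom.mul_apply,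
        ← map_mul φ, ← mul_assoc, cTwoPow_mul_self, one_mul]
  have hbij : Function.Bijective f := by
    constructor
    · intro a b h
      rw [← hgf a, ← hgf b, h]
    · intro a
      exact ⟨g (DrinfeldTwist.of.symm a), by
        have := hfg (DrinfeldTwist.of.symm a) 1
        rwa [map_one, AlgHom.one_apply, LinearEquiv.apply_symm_apply] at this⟩
  let e := (AlgEquiv.ofBijective f hbij).symm
  have he : ∀ v, e (DrinfeldTwist.of (ι v)) = QuadAlg.gen _ v := by
    intro v
    rw [AlgEquiv.symm_apply_eq]
    have h2 : (DrinfeldTwist.of : A ≃ₗ[ℂ] AlgTwist φ).toLinearMap ∘ₗ ι =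
        f.toLinearMap ∘ₗ QuadAlg.gen _ := x.ext fun i => (hfgen i).symm
    exact LinearMap.congr_fun h2 v
  refine ⟨e, he, fun m => ?_⟩
  rw [DrinfeldTwist.grading, map_of_powGrading x hφ, powGrading, powGrading]
  refine (Submodule.map_pow _ e.toAlgHom m).trans ?_
  -- Both gradings are powers of the span of the generators, so it is enough to compare them in
  -- degree one.
  rw [← LinearMap.range_comp]
  congr 2
  exact LinearMap.ext he

end TwistEquiv

/-! ### Koszulness from a contracting homotopy -/

section Criterion

variable {k A : Type*} [Field k] [Ring A] [Algebra k A] {𝒜 : ℕ → Submodule k A}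

/-- The elements of a free module supported on basis elements of index degree `n`. -/
abbrev degSupported (A : Type*) [Ring A] {J : Type} (deg : J → ℕ) (n : ℕ) :
    Submodule A (J →₀ A) :=
  Finsupp.supported A A {j | deg j = n}

theorem mem_degSupported {J : Type} {deg : J → ℕ} {n : ℕ} {z : J →₀ A} :
    z ∈ degSupported A deg n ↔ ∀ j, deg j ≠ n → z j = 0 := by
  rw [degSupported, Finsupp.mem_supported']
  rfl

theorem supportedEquivFinsupp_symm_coe {J : Type*} (s : Set J) (p : s →₀ A) (j : s) :
    ((Finsupp.supportedEquivFinsupp (R := A) s).symm p : J →₀ A) j = p j := by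
  have : Finsupp.supportedEquivFinsupp (R := A) s
    ((Finsupp.supportedEquivFinsupp (R := A) s).symm p) j = p j := by
      rw [LinearEquiv.apply_symm_apply]
  exact this

theorem mem_shiftedFree {n : ℕ} {ι : Type} {m : ℕ} {p : ι →₀ A} :
    p ∈ shiftedFree 𝒜 n ι m ↔ if n ≤ m then ∀ i, p i ∈ 𝒜 (m - n) else p = 0 := Iff.rfl

/-- An `A`-linear differential on a free module graded by `deg`, lowering `deg` by one, raising
the degree of coefficients by one, and contractible onto the augmentation, gives a linear free
resolution. -/
def LinearFreeResolution.ofHomotopy {aug : A →ₐ[k] k}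
    (haug : ∀ m, m ≠ 0 → ∀ a ∈ 𝒜 m, aug a = 0)
    {J : Type} (deg : J → ℕ) (j₀ : J) (hj₀ : ∀ j, deg j = 0 ↔ j = j₀)
    (D : (J →₀ A) →ₗ[A] (J →₀ A)) (H : (J →₀ A) → (J →₀ A))
    (hD₀ : ∀ z ∈ degSupported A deg 0, D z = 0)
    (hD : ∀ n, ∀ z ∈ degSupported A deg (n + 1), D z ∈ degSupported A deg n)
    (hH : ∀ n, ∀ z ∈ degSupported A deg n, H z ∈ degSupported A deg (n + 1))
    (hDdeg : ∀ m z, (∀ j, z j ∈ 𝒜 m) → ∀ j, D z j ∈ 𝒜 (m + 1))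
    (hDD : ∀ z, D (D z) = 0)
    (hDaug : ∀ z, aug (D z j₀) = 0)
    (hDH : ∀ z, D (H z) + H (D z) = z - Finsupp.single j₀ (algebraMap k A (aug (z j₀))))
    (hH₀ : H 0 = 0) :
    LinearFreeResolution 𝒜 aug where
  ι n := ↥{j | deg j = n}
  d n := (Finsupp.supportedEquivFinsupp (M := A) (R := A) {j | deg j = n}).toLinearMap ∘ₗ
    (D.restrict (hD n)) ∘ₗ
    (Finsupp.supportedEquivFinsupp (M := A) (R := A) {j | deg j = n + 1}).symm.toLinearMap
  e := aug.toLinearMap ∘ₗ Finsupp.lapply ⟨j₀, (hj₀ j₀).2 rfl⟩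
  e_smul a p := by simp
  d_degree n m p hp := by
    simp only [mem_shiftedFree] at hp ⊢
    by_cases h : n + 1 ≤ m
    · rw [if_pos h] at hp
      rw [if_pos (by omega)]
      rintro ⟨j, hj⟩
      have := hDdeg (m - (n + 1))
        ((Finsupp.supportedEquivFinsupp (R := A) {j | deg j = n + 1}).symm p) (fun i => ?_) j
      · rwa [show m - (n + 1) + 1 = m - n by omega] at this
      · by_cases hi : deg i = n + 1
        · rw [supportedEquivFinsupp_symm_coe _ p ⟨i, hi⟩]
          exact hp _
        · rw [mem_degSupported.1 (Subtype.property _) i hi]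
          exact zero_mem _
    · rw [if_neg h] at hp
      subst hp
      rw [map_zero]
      split_ifs
      · exact fun _ => zero_mem _
      · rfl
  e_degree m hm p hp := by
    simp only [mem_shiftedFree, Nat.zero_le, if_true, Nat.sub_zero] at hp
    exact haug m hm _ (hp _)
  exact_succ n := by
    intro p
    simp only [LinearMap.comp_apply, LinearEquiv.coe_coe, Set.mem_range,
      LinearEquiv.map_eq_zero_iff]
    set Z := (Finsupp.supportedEquivFinsupp (R := A) {j | deg j = n + 1}).symm p with hZ
    -- The preimage is sought among the elements of `J →₀ A` supported in index degree `n + 2`,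
    -- where `H` takes its values.
    rw [← (Finsupp.supportedEquivFinsupp (R := A) {j | deg j = n + 2}).toEquiv.exists_congr_right]
    constructor
    · intro h
      have h0 : D Z = 0 := congrArg Subtype.val h
      refine ⟨⟨H Z, hH _ _ Z.2⟩, ?_⟩
      rw [LinearEquiv.coe_toEquiv, LinearEquiv.symm_apply_apply, ← LinearEquiv.eq_symm_apply, ← hZ]
      refine Subtype.ext ?_
      -- For a cycle the homotopy identity reads `D (H Z) = Z`: the correction at `j₀` vanishes
      -- because `j₀` has index degree `0`, not `n + 1`.
      have h1 := hDH Z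
      have h2 : (Z : J →₀ A) j₀ = 0 :=
        mem_degSupported.1 Z.2 j₀ (by rw [(hj₀ j₀).2 rfl]; omega)
      rwa [h0, hH₀, add_zero, h2, map_zero, map_zero, Finsupp.single_zero, sub_zero] at h1
    · rintro ⟨Y, hY⟩
      rw [LinearEquiv.coe_toEquiv, LinearEquiv.symm_apply_apply, ← LinearEquiv.eq_symm_apply,
        ← hZ] at hY
      rw [← hY]
      exact Subtype.ext (hDD Y)
  exact_zero := by
    intro p
    simp only [LinearMap.comp_apply, LinearEquiv.coe_coe, Set.mem_range, Finsupp.lapply_apply,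
      AlgHom.toLinearMap_apply]
    set Z := (Finsupp.supportedEquivFinsupp (R := A) {j | deg j = 0}).symm p with hZ
    rw [← (Finsupp.supportedEquivFinsupp (R := A) {j | deg j = 0 + 1}).toEquiv.exists_congr_right,
      ← supportedEquivFinsupp_symm_coe _ p, ← hZ]
    constructor
    · intro h
      refine ⟨⟨H Z, hH _ _ Z.2⟩, ?_⟩
      rw [LinearEquiv.coe_toEquiv, LinearEquiv.symm_apply_apply, ← LinearEquiv.eq_symm_apply, ← hZ]
      refine Subtype.ext ?_
      have h1 := hDH Z
      rwa [hD₀ _ Z.2, hH₀, add_zero, h, map_zero, Finsupp.single_zero, sub_zero] at h1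
    · rintro ⟨Y, hY⟩
      rw [LinearEquiv.coe_toEquiv, LinearEquiv.symm_apply_apply, ← LinearEquiv.eq_symm_apply,
        ← hZ] at hY
      rw [← hY]
      exact hDaug Y
  surjective c := ⟨Finsupp.single ⟨j₀, (hj₀ j₀).2 rfl⟩ (algebraMap k A c), by simp⟩

/-- Transport of a linear free resolution along an isomorphism of graded algebras. -/
def LinearFreeResolution.ofAlgEquiv {B : Type*} [Ring B] [Algebra k B] {ℬ : ℕ → Submodule k B}
    {aug : B →ₐ[k] k} (e : A ≃ₐ[k] B) (hmem : ∀ m a, e a ∈ ℬ m ↔ a ∈ 𝒜 m)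
    (P : LinearFreeResolution ℬ aug) : LinearFreeResolution 𝒜 (aug.comp e.toAlgHom) where
  ι := P.ι
  d n :=
    { toFun p := (P.d n (p.mapRange e (map_zero e))).mapRange e.symm (map_zero e.symm)
      map_add' p q := by
        rw [Finsupp.mapRange_add (map_add e), map_add, Finsupp.mapRange_add (map_add e.symm)]
      map_smul' a p := by
        have h : (a • p).mapRange e (map_zero e) = e a • p.mapRange e (map_zero e) := by
          ext i; simp
        rw [h, map_smul]
        ext i; simp }
  e := P.e ∘ₗ Finsupp.mapRange.linearMap e.toLinearMap
  e_smul a p := by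
    have h : Finsupp.mapRange.linearMap e.toLinearMap (a • p) =
        e a • Finsupp.mapRange.linearMap e.toLinearMap p := by
      ext i; simp
    rw [LinearMap.comp_apply, h, P.e_smul]
    rfl
  d_degree n m p hp := by
    have h := P.d_degree n m (p.mapRange e (map_zero e))
    simp only [mem_shiftedFree] at h hp ⊢
    change if n ≤ m then ∀ i, e.symm _ ∈ _ else _
    have h1 : if n + 1 ≤ m then ∀ i, (p.mapRange e (map_zero e)) i ∈ ℬ (m - (n + 1))
        else p.mapRange e (map_zero e) = 0 := by
      split_ifs at hp ⊢ with hn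
      · intro i; rw [Finsupp.mapRange_apply, hmem]; exact hp i
      · rw [hp, Finsupp.mapRange_zero]
    replace h := h h1
    split_ifs at h ⊢ with hn
    · intro i
      rw [← hmem, AlgEquiv.apply_symm_apply]
      exact h i
    · change Finsupp.mapRange e.symm (map_zero e.symm) _ = 0
      rw [h, Finsupp.mapRange_zero]
  e_degree m hm p hp := by
    refine P.e_degree m hm _ ?_
    simp only [mem_shiftedFree, Nat.zero_le, if_true] at hp ⊢
    exact fun i => (hmem _ _).2 (hp i)
  exact_succ n := by
    intro p
    change (Finsupp.mapRange e.symm (map_zero e.symm) _ = 0) ↔ _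
    have h0 : ∀ q : P.ι n →₀ B, q.mapRange e.symm (map_zero e.symm) = 0 ↔ q = 0 := fun q => by
      simp [Finsupp.ext_iff]
    rw [h0, P.exact_succ n _]
    constructor
    · rintro ⟨q, hq⟩
      refine ⟨q.mapRange e.symm (map_zero e.symm), ?_⟩
      change Finsupp.mapRange e.symm (map_zero e.symm) (P.d _ _) = _
      have h2 : (q.mapRange e.symm (map_zero e.symm)).mapRange e (map_zero e) = q := by
        ext i; simp
      rw [h2, hq]
      ext i; simp
    · rintro ⟨q, rfl⟩
      refine ⟨q.mapRange e (map_zero e), ?_⟩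
      change _ = Finsupp.mapRange e (map_zero e) (Finsupp.mapRange e.symm (map_zero e.symm) (P.d _ _))
      ext i; simp
  exact_zero := by
    intro p
    refine (P.exact_zero _).trans ?_
    constructor
    · rintro ⟨q, hq⟩
      refine ⟨q.mapRange e.symm (map_zero e.symm), ?_⟩
      change Finsupp.mapRange e.symm (map_zero e.symm) (P.d _ _) = _
      have h2 : (q.mapRange e.symm (map_zero e.symm)).mapRange e (map_zero e) = q := by
        ext i; simp
      rw [h2, hq]
      ext i; simp
    · rintro ⟨q, rfl⟩
      refine ⟨q.mapRange e (map_zero e), ?_⟩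
      change _ = Finsupp.mapRange e (map_zero e) (Finsupp.mapRange e.symm (map_zero e.symm) (P.d _ _))
      ext i; simp
  surjective := by
    refine P.surjective.comp fun q => ⟨q.mapRange e.symm (map_zero e.symm), ?_⟩
    ext i; simp

/-- Koszulness is transported along isomorphisms of graded algebras. -/
theorem IsKoszul.of_algEquiv {B : Type*} [Ring B] [Algebra k B] {ℬ : ℕ → Submodule k B}
    (e : A ≃ₐ[k] B) (he : ∀ m, (𝒜 m).map e.toLinearMap = ℬ m) (hB : IsKoszul ℬ) :
    IsKoszul 𝒜 := by
  have hmem : ∀ m a, e a ∈ ℬ m ↔ a ∈ 𝒜 m := fun m a => by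
    rw [← he]
    constructor
    · rintro ⟨b, hb, h⟩
      rwa [← e.injective h]
    · exact fun h => ⟨a, h, rfl⟩
  have hg := hB.graded
  obtain ⟨aug, haug, ⟨P⟩⟩ := hB.resolution
  refine ⟨⟨?_, ?_, ?_, ?_, ?_⟩, aug.comp e.toAlgHom, ?_, ⟨P.ofAlgEquiv e hmem⟩⟩
  · exact
      { one_mem := by
          rw [← hmem, map_one]
          exact hg.gradedMonoid.one_mem
        mul_mem := fun i j a b ha hb => by
          rw [← hmem] at ha hb ⊢
          rw [map_mul]
          exact hg.gradedMonoid.mul_mem ha hb }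
  · have h := hg.isInternal
    rw [DirectSum.isInternal_submodule_iff_iSupIndep_and_iSup_eq_top] at h ⊢
    have hℬ : ℬ = Submodule.orderIsoMapComap e.toLinearEquiv ∘ 𝒜 := funext fun m => (he m).symm
    rw [hℬ, iSupIndep_map_orderIso_iff] at h
    refine ⟨h.1, (Submodule.orderIsoMapComap e.toLinearEquiv).injective ?_⟩
    rw [OrderIso.map_iSup, OrderIso.map_top]
    exact h.2
  · ext a
    rw [← hmem, hg.connected, Submodule.mem_one, Submodule.mem_one]
    refine exists_congr fun c => ?_
    rw [← e.injective.eq_iff, e.commutes]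
  · have h : ⇑(algebraMap k B) = e ∘ algebraMap k A := by ext c; simp
    have := hg.injective
    rw [h] at this
    exact this.of_comp
  · intro m
    have := hg.finite m
    let e' : ℬ m ≃ₗ[k] 𝒜 m := (LinearEquiv.ofEq _ _ (he m).symm).trans
      (e.toLinearEquiv.submoduleMap (𝒜 m)).symm
    exact Module.Finite.equiv e'
  · exact fun m hm a ha => haug m hm _ ((hmem m a).2 ha)

end Criterion

/-! ### Koszulness checked in coordinates -/

section Model

variable {k A : Type*} [Field k] [Ring A] [Algebra k A] {𝒜 : ℕ → Submodule k A}

/-- Coordinates on a free module over `A` given by a `k`-basis of `A`. -/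
def freeCoord {I J P : Type*} (m : Module.Basis I k A) (σ : J × I ≃ P) :
    (J →₀ A) ≃ₗ[k] (P →₀ k) :=
  (Finsupp.mapRange.linearEquiv m.repr).trans
    ((Finsupp.curryLinearEquiv k).symm.trans (Finsupp.domLCongr σ))

theorem freeCoord_apply {I J P : Type*} (m : Module.Basis I k A) (σ : J × I ≃ P) (z : J →₀ A)
    (j : J) (i : I) : freeCoord m σ z (σ (j, i)) = m.repr (z j) i := by
  simp [freeCoord, Finsupp.domLCongr_apply, Finsupp.domCongr_apply, Finsupp.equivMapDomain_apply,
    Finsupp.curryLinearEquiv, Finsupp.uncurry]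

theorem freeCoord_single {I J P : Type*} (m : Module.Basis I k A) (σ : J × I ≃ P)
    (j : J) (i : I) : freeCoord m σ (Finsupp.single j (m i)) = Finsupp.single (σ (j, i)) 1 := by
  classical
  ext p
  obtain ⟨⟨j', i'⟩, rfl⟩ := σ.surjective p
  rw [freeCoord_apply, Finsupp.single_apply, Finsupp.single_apply]
  by_cases h : j = j'
  · simp [h, Finsupp.single_apply]
  · simp [h]

theorem freeCoord_mem_supported {I J P : Type*} (m : Module.Basis I k A) (σ : J × I ≃ P)
    {deg : J → ℕ} {dg : P → ℕ} (hdg : ∀ j i, dg (σ (j, i)) = deg j) (n : ℕ) (z : J →₀ A) :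
    freeCoord m σ z ∈ Finsupp.supported k k {p | dg p = n} ↔ ∀ j, deg j ≠ n → z j = 0 := by
  rw [Finsupp.mem_supported']
  constructor
  · intro h j hj
    refine m.repr.injective (Finsupp.ext fun i => ?_)
    rw [← freeCoord_apply m σ, h _ (by simpa [hdg] using hj)]
    simp
  · intro h p hp
    obtain ⟨⟨j, i⟩, rfl⟩ := σ.surjective p
    rw [freeCoord_apply, h j (by simpa [hdg] using hp)]
    simp

theorem map_mem_supported {P : Type*} {s : Set P} {S : Submodule k (P →₀ k)}
    (T : (P →₀ k) →ₗ[k] (P →₀ k)) (hT : ∀ p ∈ s, T (Finsupp.single p 1) ∈ S)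
    {z : P →₀ k} (hz : z ∈ Finsupp.supported k k s) : T z ∈ S := by
  rw [Finsupp.supported_eq_span_single] at hz
  induction hz using Submodule.span_induction with
  | mem z hz => obtain ⟨p, hp, rfl⟩ := hz; exact hT p hp
  | zero => rw [map_zero]; exact zero_mem _
  | add a b _ _ ha hb => rw [map_add]; exact add_mem ha hb
  | smul r a _ ha => rw [map_smul]; exact Submodule.smul_mem _ _ ha

theorem linearCombination_apply_mem {J : Type*} (h𝒜 : SetLike.GradedMonoid 𝒜)
    {δ : J → J →₀ A} (hδ : ∀ j j', δ j j' ∈ 𝒜 1) {m : ℕ} {z : J →₀ A} (hz : ∀ j, z j ∈ 𝒜 m)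
    (j' : J) : Finsupp.linearCombination A δ z j' ∈ 𝒜 (m + 1) := by
  rw [Finsupp.linearCombination_apply, Finsupp.sum, Finsupp.finsetSum_apply]
  exact sum_mem fun j _ => h𝒜.mul_mem (hz j) (hδ j j')

theorem map_linearCombination_apply_eq_zero {J : Type*} {B : Type*} [Ring B] [Algebra k B]
    (f : A →ₐ[k] B) {δ : J → J →₀ A} (hδ : ∀ j j', f (δ j j') = 0) (z : J →₀ A)
    (j' : J) : f (Finsupp.linearCombination A δ z j') = 0 := by
  rw [Finsupp.linearCombination_apply, Finsupp.sum, Finsupp.finsetSum_apply, map_sum]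
  exact Finset.sum_eq_zero fun j _ => by simp [hδ]

/-- Koszulness of an algebra with a basis `m`, from a complex in coordinates with a contracting
homotopy. -/
theorem isKoszul_of_coord (h𝒜 : IsConnectedGraded 𝒜) {aug : A →ₐ[k] k}
    (haug : ∀ m, m ≠ 0 → ∀ a ∈ 𝒜 m, aug a = 0)
    {J : Type} {I P : Type*} (σ : J × I ≃ P) {deg : J → ℕ} {dg : P → ℕ}
    (hdg : ∀ j i, dg (σ (j, i)) = deg j) {j₀ : J} (hj₀ : ∀ j, deg j = 0 ↔ j = j₀)
    (m : Module.Basis I k A) {i₀ : I} (hm₀ : m i₀ = 1) (hm : ∀ i, i ≠ i₀ → aug (m i) = 0)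
    (δ : J → J →₀ A) (hδ : ∀ j j', δ j j' ∈ 𝒜 1)
    (D H : (P →₀ k) →ₗ[k] (P →₀ k))
    (hcomp : ∀ j i, freeCoord m σ (m i • δ j) = D (Finsupp.single (σ (j, i)) 1))
    (hD : ∀ p q, D (Finsupp.single p 1) q ≠ 0 → dg q + 1 = dg p)
    (hH : ∀ p q, H (Finsupp.single p 1) q ≠ 0 → dg q = dg p + 1)
    (hDD : D ∘ₗ D = 0)
    (hDH : ∀ p, p ≠ σ (j₀, i₀) → D (H (Finsupp.single p 1)) + H (D (Finsupp.single p 1)) =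
      Finsupp.single p 1)
    (hDH₀ : D (H (Finsupp.single (σ (j₀, i₀)) 1)) + H (D (Finsupp.single (σ (j₀, i₀)) 1)) = 0) :
    IsKoszul 𝒜 := by
  let Φ := freeCoord m σ
  let DA : (J →₀ A) →ₗ[A] (J →₀ A) := Finsupp.linearCombination A δ
  have hΦD : ∀ z, Φ (DA z) = D (Φ z) := by
    -- Both sides are `k`-linear, so it is enough to compare them on `m i` placed at `j`; there
    -- `hcomp` is the claim.
    have h : Φ.toLinearMap ∘ₗ DA.restrictScalars k = D ∘ₗ Φ.toLinearMap := by
      refine Finsupp.lhom_ext' fun j => m.ext fun i => ?_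
      simp only [LinearMap.comp_apply, Finsupp.lsingle_apply, LinearMap.restrictScalars_apply,
        LinearEquiv.coe_coe, Φ, freeCoord_single, DA, Finsupp.linearCombination_single, hcomp]
    exact LinearMap.congr_fun h
  have hsupp : ∀ n z, z ∈ degSupported A deg n ↔
      Φ z ∈ Finsupp.supported k k {p | dg p = n} := fun n z => by
    rw [mem_degSupported, freeCoord_mem_supported m σ hdg]
  have hD' : ∀ n, ∀ z ∈ Finsupp.supported k k {p | dg p = n + 1},
      D z ∈ Finsupp.supported k k {p | dg p = n} := fun n z hz => by
    refine map_mem_supported D (fun p hp => ?_) hz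
    rw [Finsupp.mem_supported']
    intro q hq
    by_contra h
    have := hD p q h
    simp only [Set.mem_ofPred_eq] at hp hq
    omega
  have hD₀ : ∀ z ∈ Finsupp.supported k k {p | dg p = 0}, D z = 0 := fun z hz => by
    have := map_mem_supported (S := ⊥) D (fun p hp => ?_) hz
    · simpa using this
    · rw [Submodule.mem_bot]
      ext q
      by_contra h
      have := hD p q h
      simp only [Set.mem_ofPred_eq] at hp
      omega
  have hH' : ∀ n, ∀ z ∈ Finsupp.supported k k {p | dg p = n},
      H z ∈ Finsupp.supported k k {p | dg p = n + 1} := fun n z hz => by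
    refine map_mem_supported H (fun p hp => ?_) hz
    rw [Finsupp.mem_supported']
    intro q hq
    by_contra h
    have := hH p q h
    simp only [Set.mem_ofPred_eq] at hp hq
    omega
  -- In coordinates the augmentation term is the projection onto the single basis vector at `(j₀,
  -- i₀)`, since `aug` kills every other `m i`.
  have hDH' : ∀ z, Φ.symm (D (H (Φ z)) + H (D (Φ z))) =
      z - Finsupp.single j₀ (algebraMap k A (aug (z j₀))) := by
    have h : Φ.symm.toLinearMap ∘ₗ (D ∘ₗ H + H ∘ₗ D) ∘ₗ Φ.toLinearMap =
        LinearMap.id - Finsupp.lsingle j₀ ∘ₗ Algebra.linearMap k A ∘ₗ aug.toLinearMap ∘ₗ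
          Finsupp.lapply j₀ := by
      refine Finsupp.lhom_ext' fun j => m.ext fun i => ?_
      simp only [LinearMap.comp_apply, Finsupp.lsingle_apply, LinearMap.add_apply,
        LinearMap.sub_apply, LinearEquiv.coe_coe, Φ, freeCoord_single, LinearMap.id_apply,
        Finsupp.lapply_apply, AlgHom.toLinearMap_apply, Algebra.linearMap_apply]
      by_cases hj : j = j₀
      · subst hj
        by_cases hi : i = i₀
        · subst hi
          rw [hDH₀, map_zero, Finsupp.single_eq_same, hm₀, map_one aug,
            map_one (algebraMap k A)]
          exact (sub_self _).symm
        · rw [hDH _ (fun h => hi (congrArg Prod.snd (σ.injective h))), ← freeCoord_single m,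
            LinearEquiv.symm_apply_apply, Finsupp.single_eq_same, hm i hi, map_zero,
            Finsupp.single_zero, sub_zero]
      · rw [hDH _ (fun h => hj (congrArg Prod.fst (σ.injective h))),
          ← freeCoord_single m, LinearEquiv.symm_apply_apply,
          Finsupp.single_eq_of_ne (Ne.symm hj), map_zero, map_zero, Finsupp.single_zero, sub_zero]
    exact LinearMap.congr_fun h
  refine ⟨h𝒜, aug, haug, ⟨LinearFreeResolution.ofHomotopy haug deg j₀ hj₀ DA
    (fun z => Φ.symm (H (Φ z))) ?_ ?_ ?_ ?_ ?_ ?_ ?_ ?_⟩⟩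
  · intro z hz
    apply Φ.injective
    rw [hΦD, map_zero]
    exact hD₀ _ ((hsupp 0 z).1 hz)
  · intro n z hz
    rw [hsupp, hΦD]
    exact hD' n _ ((hsupp _ z).1 hz)
  · intro n z hz
    rw [hsupp, LinearEquiv.apply_symm_apply]
    exact hH' n _ ((hsupp _ z).1 hz)
  · exact fun m z hz => linearCombination_apply_mem h𝒜.gradedMonoid hδ hz
  · intro z
    apply Φ.injective
    rw [hΦD, hΦD, map_zero]
    exact LinearMap.congr_fun hDD _
  · exact fun z => map_linearCombination_apply_eq_zero aug
      (fun j j' => haug 1 one_ne_zero _ (hδ j j')) z j₀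
  · intro z
    rw [← hDH' z, map_add]
    refine congrArg₂ (· + ·) ?_ ?_
    · rw [LinearEquiv.eq_symm_apply, hΦD, LinearEquiv.apply_symm_apply]
    · rw [hΦD]
  · simp

end Model

/-! ### The twisted Koszul and de Rham differentials in coordinates -/

section Complex

variable {n : ℕ}

/-- The sign of moving `x i` past the variables `x j`, `i < j`, of the monomial with exponent
`a`. -/
def moveSign (i : Fin n) (a : Fin n →₀ ℕ) : ℂ := ∏ j, (((tAbove i j : ℤˣ) : ℤ) : ℂ) ^ a j

theorem moveSign_add (i : Fin n) (a b : Fin n →₀ ℕ) :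
    moveSign i (a + b) = moveSign i a * moveSign i b := by
  simp [moveSign, pow_add, Finset.prod_mul_distrib]

theorem moveSign_single (i j : Fin n) :
    moveSign i (Finsupp.single j 1) = if i < j then -1 else 1 := by
  rw [moveSign, Finset.prod_eq_single j]
  · simp only [tAbove, Finsupp.single_eq_same]
    split_ifs <;> simp
  · intro k _ hk
    rw [Finsupp.single_eq_of_ne hk, pow_zero]
  · simp

theorem moveSign_mul_self (i : Fin n) (a : Fin n →₀ ℕ) : moveSign i a * moveSign i a = 1 := by
  rw [moveSign, ← Finset.prod_mul_distrib]
  refine Finset.prod_eq_one fun j _ => ?_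
  rw [← mul_pow]
  simp only [tAbove]
  split_ifs <;> simp

/-- Subtraction of exponents truncates only when `a j = 0`, and there the factor `a j` kills both
sides. Otherwise the sign is multiplicative and its own inverse. -/
theorem coe_mul_moveSign_tsub (i j : Fin n) (a : Fin n →₀ ℕ) :
    (a j : ℂ) * moveSign i (a - Finsupp.single j 1) =
      a j * (moveSign i a * moveSign i (Finsupp.single j 1)) := by
  by_cases h : a j = 0
  · simp [h]
  · have h2 : a = (a - Finsupp.single j 1) + Finsupp.single j 1 := by
      rw [tsub_add_cancel_of_le]
      rwa [Finsupp.single_le_iff, Nat.one_le_iff_ne_zero]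
    conv_rhs => rw [h2, moveSign_add, mul_assoc, moveSign_mul_self, mul_one, ← h2]

/-- Exactly one of `i < j` and `j < i` holds. This is the source of every anticommutation below. -/
theorem moveSign_single_swap {i j : Fin n} (h : i ≠ j) :
    moveSign i (Finsupp.single j 1) = -moveSign j (Finsupp.single i 1) := by
  rw [moveSign_single, moveSign_single]
  rcases lt_or_gt_of_ne h with h | h
  · simp [h, h.not_gt]
  · simp [h, h.not_gt]

/-- The underlying space of the Koszul complex: `(a, b)` stands for a monomial `x ^ a` and a
squarefree monomial supported on `b`. -/
abbrev KoszulSpace (n : ℕ) : Type := ((Fin n →₀ ℕ) × Finset (Fin n)) →₀ ℂ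

/-- The `i`-th summand of the twisted Koszul differential. -/
def kosSummand (i : Fin n) : Module.End ℂ (KoszulSpace n) :=
  Finsupp.linearCombination ℂ fun p =>
    if i ∈ p.2 then moveSign i p.1 • Finsupp.single (p.1 + Finsupp.single i 1, p.2.erase i) 1
    else 0

/-- The `i`-th summand of the twisted de Rham differential. -/
def derSummand (i : Fin n) : Module.End ℂ (KoszulSpace n) :=
  Finsupp.linearCombination ℂ fun p =>
    if i ∈ p.2 then 0
    else (p.1 i * moveSign i p.1 : ℂ) • Finsupp.single (p.1 - Finsupp.single i 1, insert i p.2) 1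

theorem kosSummand_single (i : Fin n) (a : Fin n →₀ ℕ) (b : Finset (Fin n)) :
    kosSummand i (Finsupp.single (a, b) 1) =
      if i ∈ b then moveSign i a • Finsupp.single (a + Finsupp.single i 1, b.erase i) 1 else 0 := by
  rw [kosSummand, Finsupp.linearCombination_single, one_smul]

theorem derSummand_single (i : Fin n) (a : Fin n →₀ ℕ) (b : Finset (Fin n)) :
    derSummand i (Finsupp.single (a, b) 1) =
      if i ∈ b then 0
      else (a i * moveSign i a : ℂ) • Finsupp.single (a - Finsupp.single i 1, insert i b) 1 := by
  rw [derSummand, Finsupp.linearCombination_single, one_smul]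

theorem koszulSpace_end_ext {f g : Module.End ℂ (KoszulSpace n)}
    (h : ∀ a b, f (Finsupp.single (a, b) 1) = g (Finsupp.single (a, b) 1)) : f = g :=
  Finsupp.lhom_ext' fun p => LinearMap.ext_ring (h p.1 p.2)

/-- In the classical Koszul complex the sign comes from the exterior factor. Here the squarefree
monomials commute, and the sign comes from moving `x i` and `x j` past each other in the monomial `x
^ a`. -/
theorem kosSummand_mul (i j : Fin n) :
    kosSummand i * kosSummand j = -(kosSummand j * kosSummand i) := by
  refine koszulSpace_end_ext fun a b => ?_
  rw [LinearMap.neg_apply, Module.End.mul_apply, Module.End.mul_apply, kosSummand_single,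
    kosSummand_single]
  by_cases hij : i = j
  · subst hij
    split_ifs <;> simp only [map_smul, map_zero, kosSummand_single, Finset.notMem_erase, if_false,
      smul_zero, neg_zero]
  · by_cases hi : i ∈ b <;> by_cases hj : j ∈ b <;>
      simp only [hi, hj, if_true, if_false, map_smul, map_zero, kosSummand_single,
        Finset.mem_erase, ne_eq, hij, Ne.symm hij, not_false_eq_true, and_self, and_false,
        smul_zero, neg_zero, smul_smul, moveSign_add]
    rw [Finset.erase_right_comm, add_right_comm, ← neg_smul, moveSign_single_swap hij]
    congr 1
    ring

theorem derSummand_mul (i j : Fin n) :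
    derSummand i * derSummand j = -(derSummand j * derSummand i) := by
  refine koszulSpace_end_ext fun a b => ?_
  rw [LinearMap.neg_apply, Module.End.mul_apply, Module.End.mul_apply, derSummand_single,
    derSummand_single]
  by_cases hij : i = j
  · subst hij
    split_ifs <;> simp only [map_smul, map_zero, derSummand_single, Finset.mem_insert_self, if_true,
      smul_zero, neg_zero]
  · by_cases hi : i ∈ b <;> by_cases hj : j ∈ b <;>
      simp only [hi, hj, if_true, if_false, map_smul, map_zero, derSummand_single,
        Finset.mem_insert, hij, Ne.symm hij, or_true, or_false,
        smul_zero, neg_zero, smul_smul]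
    -- Only the case where neither index lies in `b` survives.
    rw [Finset.insert_comm, tsub_right_comm, ← neg_smul]
    congr 1
    rw [Finsupp.tsub_apply, Finsupp.tsub_apply, Finsupp.single_eq_of_ne hij,
      Finsupp.single_eq_of_ne (Ne.symm hij), tsub_zero, tsub_zero]
    have h1 := coe_mul_moveSign_tsub i j a
    have h2 := coe_mul_moveSign_tsub j i a
    have h3 := moveSign_single_swap hij
    linear_combination (moveSign j a * a i) * h1 + (moveSign i a * a j) * h2 +
      (a i * a j * moveSign i a * moveSign j a) * h3

theorem kosSummand_mul_derSummand {i j : Fin n} (hij : i ≠ j) :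
    kosSummand i * derSummand j = -(derSummand j * kosSummand i) := by
  refine koszulSpace_end_ext fun a b => ?_
  rw [LinearMap.neg_apply, Module.End.mul_apply, Module.End.mul_apply, derSummand_single,
    kosSummand_single]
  by_cases hi : i ∈ b <;> by_cases hj : j ∈ b <;>
    simp only [hi, hj, if_true, if_false, map_smul, map_zero, derSummand_single,
      kosSummand_single, Finset.mem_insert, Finset.mem_erase, hij, Ne.symm hij, or_true, or_false,
      smul_zero, neg_zero, smul_smul, and_false, and_true, ne_eq, not_false_eq_true]
  have ha : a - Finsupp.single j 1 + Finsupp.single i 1 =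
      a + Finsupp.single i 1 - Finsupp.single j 1 := by
    ext k
    by_cases hk : k = i
    · subst hk; simp [Finsupp.single_eq_of_ne hij]
    · simp [Finsupp.single_eq_of_ne hk]
  rw [← Finset.erase_insert_of_ne (Ne.symm hij), ha, ← neg_smul]
  congr 1
  rw [Finsupp.add_apply, Finsupp.single_eq_of_ne (Ne.symm hij), add_zero, moveSign_add]
  have h1 := coe_mul_moveSign_tsub i j a
  have h3 := moveSign_single_swap hij
  linear_combination (moveSign j a) * h1 + (a j * moveSign i a * moveSign j a) * h3

/-- The operator multiplying the basis vector at `p` by `w p`. -/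
def diagOp {P : Type*} (w : P → ℂ) : Module.End ℂ (P →₀ ℂ) :=
  Finsupp.linearCombination ℂ fun p => Finsupp.single p (w p)

theorem diagOp_single {P : Type*} (w : P → ℂ) (p : P) :
    diagOp w (Finsupp.single p 1) = w p • Finsupp.single p 1 := by
  rw [diagOp, Finsupp.linearCombination_single, one_smul, Finsupp.smul_single_one]

/-- If `i ∈ b`, only `derSummand i * kosSummand i` survives and gives `a i + 1`; otherwise only the
other product does and gives `a i`. The signs cancel, because `moveSign i` ignores the exponent of
`x i` and squares to `1`. -/
theorem kosSummand_mul_derSummand_self (i : Fin n) :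
    kosSummand i * derSummand i + derSummand i * kosSummand i =
      diagOp fun p => (p.1 i + if i ∈ p.2 then 1 else 0 : ℂ) := by
  refine koszulSpace_end_ext fun a b => ?_
  rw [LinearMap.add_apply, Module.End.mul_apply, Module.End.mul_apply, derSummand_single,
    kosSummand_single, diagOp_single]
  by_cases hi : i ∈ b
  · simp only [hi, if_true, map_zero, map_smul, derSummand_single, Finset.notMem_erase, if_false,
      Finset.insert_erase, add_tsub_cancel_right, zero_add, smul_smul, moveSign_add,
      moveSign_single, lt_irrefl, Finsupp.add_apply, Finsupp.single_eq_same]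
    congr 1
    push_cast
    linear_combination (a i + 1 : ℂ) * moveSign_mul_self i a
  · simp only [hi, if_false, map_zero, map_smul, kosSummand_single, Finset.mem_insert_self,
      if_true, add_zero, smul_smul, Finset.erase_insert hi]
    have h1 := coe_mul_moveSign_tsub i i a
    rw [moveSign_single, if_neg (lt_irrefl i), mul_one] at h1
    have h2 : (a i * moveSign i a * moveSign i (a - Finsupp.single i 1) : ℂ) = a i := by
      linear_combination (moveSign i a) * h1 + (a i : ℂ) * moveSign_mul_self i a
    rw [h2]
    -- When `a i = 0`, subtracting and adding back `single i 1` does not return `a`, but the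
    -- coefficient is zero.
    by_cases ha : a i = 0
    · simp [ha]
    · rw [tsub_add_cancel_of_le]
      rwa [Finsupp.single_le_iff, Nat.one_le_iff_ne_zero]

theorem sum_sq_eq_zero_of_anticommute {R : Type*} [Ring R] [Module ℂ R] {u : Fin n → R}
    (h : ∀ i j, u i * u j = -(u j * u i)) : (∑ i, u i) * ∑ i, u i = 0 := by
  have h1 : (∑ i, u i) * ∑ i, u i = -((∑ i, u i) * ∑ i, u i) := by
    conv_lhs => rw [Finset.sum_mul_sum, Finset.sum_comm]
    rw [Finset.sum_mul_sum, ← Finset.sum_neg_distrib]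
    refine Finset.sum_congr rfl fun i _ => ?_
    rw [← Finset.sum_neg_distrib]
    exact Finset.sum_congr rfl fun j _ => h j i
  rw [eq_neg_iff_add_eq_zero, ← two_smul ℂ] at h1
  exact (smul_eq_zero.1 h1).resolve_left two_ne_zero

/-- The twisted Koszul differential. -/
def kosD (n : ℕ) : Module.End ℂ (KoszulSpace n) := ∑ i, kosSummand i

/-- The twisted de Rham differential. -/
def derD (n : ℕ) : Module.End ℂ (KoszulSpace n) := ∑ i, derSummand i

theorem kosD_sq : kosD n * kosD n = 0 := by
  rw [kosD]; exact sum_sq_eq_zero_of_anticommute (R := Module.End ℂ (KoszulSpace n)) kosSummand_mul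

theorem derD_sq : derD n * derD n = 0 := by
  rw [derD]; exact sum_sq_eq_zero_of_anticommute (R := Module.End ℂ (KoszulSpace n)) derSummand_mul

/-- The total degree. -/
def totalDeg (p : (Fin n →₀ ℕ) × Finset (Fin n)) : ℕ := p.1.degree + p.2.card

theorem totalDeg_eq_zero {p : (Fin n →₀ ℕ) × Finset (Fin n)} : totalDeg p = 0 ↔ p = (0, ∅) := by
  rw [totalDeg, Nat.add_eq_zero_iff, Finsupp.degree_eq_zero_iff, Finset.card_eq_zero, Prod.ext_iff]

theorem diagOp_sum {P ι : Type*} (S : Finset ι) (w : ι → P → ℂ) :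
    ∑ i ∈ S, diagOp (w i) = diagOp fun p => ∑ i ∈ S, w i p := by
  refine Finsupp.lhom_ext' fun p => LinearMap.ext_ring ?_
  simp only [LinearMap.comp_apply, Finsupp.lsingle_apply, LinearMap.sum_apply, diagOp_single,
    Finset.sum_smul]

/-- This is the Euler formula: terms with `i ≠ j` cancel, and the diagonal terms add up the degrees
in the separate variables. -/
theorem kosD_mul_derD_add : kosD n * derD n + derD n * kosD n =
    diagOp fun p => (totalDeg p : ℂ) := by
  have h : ∀ i j : Fin n, kosSummand i * derSummand j + derSummand j * kosSummand i =
      if i = j then diagOp fun p => (p.1 i + if i ∈ p.2 then 1 else 0 : ℂ) else 0 := by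
    intro i j
    split_ifs with hij
    · subst hij; exact kosSummand_mul_derSummand_self i
    · rw [kosSummand_mul_derSummand hij]
      exact neg_add_cancel (derSummand j * kosSummand i)
  rw [kosD, derD, Finset.sum_mul_sum, Finset.sum_mul_sum (f := derSummand),
    Finset.sum_comm (f := fun i j => derSummand i * kosSummand j), ← Finset.sum_add_distrib]
  simp only [← Finset.sum_add_distrib, h, Finset.sum_ite_eq, Finset.mem_univ, if_true]
  rw [diagOp_sum]
  congr 1
  funext p
  rw [totalDeg, Finsupp.degree_eq_sum, Finset.sum_add_distrib, Nat.cast_add, Nat.cast_sum,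
    Finset.sum_ite_mem, Finset.univ_inter, Finset.sum_const, nsmul_eq_mul, mul_one]

theorem kosD_single (a : Fin n →₀ ℕ) (b : Finset (Fin n)) :
    kosD n (Finsupp.single (a, b) 1) =
      ∑ i, if i ∈ b then moveSign i a • Finsupp.single (a + Finsupp.single i 1, b.erase i) 1
        else 0 := by
  simp only [kosD, LinearMap.sum_apply, kosSummand_single]

theorem derD_single (a : Fin n →₀ ℕ) (b : Finset (Fin n)) :
    derD n (Finsupp.single (a, b) 1) =
      ∑ i, if i ∈ b then 0
        else (a i * moveSign i a : ℂ) •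
          Finsupp.single (a - Finsupp.single i 1, insert i b) 1 := by
  simp only [derD, LinearMap.sum_apply, derSummand_single]

/-- The bidegree of `kosD` is `(1, -1)`. It thus preserves the total degree, which makes it commute
with `invDeg`, and it shifts each index degree by one, as a resolution requires. -/
theorem kosD_single_apply_ne_zero {p q : (Fin n →₀ ℕ) × Finset (Fin n)}
    (h : kosD n (Finsupp.single p 1) q ≠ 0) :
    q.1.degree = p.1.degree + 1 ∧ q.2.card + 1 = p.2.card := by
  obtain ⟨a, b⟩ := p
  rw [kosD_single, Finsupp.finsetSum_apply] at h
  obtain ⟨i, -, hi⟩ := Finset.exists_ne_zero_of_sum_ne_zero h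
  split_ifs at hi with hib
  · rw [Finsupp.smul_apply, Finsupp.single_apply] at hi
    split_ifs at hi with hq
    · subst hq
      exact ⟨by simp, Finset.card_erase_add_one hib⟩
    · simp at hi
  · simp at hi

theorem derD_single_apply_ne_zero {p q : (Fin n →₀ ℕ) × Finset (Fin n)}
    (h : derD n (Finsupp.single p 1) q ≠ 0) :
    q.1.degree + 1 = p.1.degree ∧ q.2.card = p.2.card + 1 := by
  obtain ⟨a, b⟩ := p
  rw [derD_single, Finsupp.finsetSum_apply] at h
  obtain ⟨i, -, hi⟩ := Finset.exists_ne_zero_of_sum_ne_zero h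
  split_ifs at hi with hib
  · simp at hi
  · rw [Finsupp.smul_apply, Finsupp.single_apply] at hi
    split_ifs at hi with hq
    · subst hq
      refine ⟨?_, Finset.card_insert_of_notMem hib⟩
      have ha : a i ≠ 0 := fun ha => hi (by simp [ha])
      have h2 : a = (a - Finsupp.single i 1) + Finsupp.single i 1 := by
        rw [tsub_add_cancel_of_le]
        rwa [Finsupp.single_le_iff, Nat.one_le_iff_ne_zero]
      conv_rhs => rw [h2, map_add, Finsupp.degree_single]
    · simp at hi

/-- Division by the total degree. -/
def invDeg (n : ℕ) : Module.End ℂ (KoszulSpace n) := diagOp fun p => (totalDeg p : ℂ)⁻¹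

theorem diagOp_apply {P : Type*} (w : P → ℂ) (z : P →₀ ℂ) (q : P) :
    diagOp w z q = w q * z q := by
  classical
  have h : (Finsupp.lapply q) ∘ₗ diagOp w = w q • (Finsupp.lapply q : (P →₀ ℂ) →ₗ[ℂ] ℂ) := by
    refine Finsupp.lhom_ext' fun p => LinearMap.ext_ring ?_
    simp only [LinearMap.comp_apply, Finsupp.lsingle_apply, diagOp_single, Finsupp.lapply_apply,
      LinearMap.smul_apply, Finsupp.smul_apply, Finsupp.single_apply, smul_eq_mul]
    split_ifs with hpq
    · rw [hpq]
    · simp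
  exact LinearMap.congr_fun h z

theorem diagOp_commute {P : Type*} {w : P → ℂ} {T : Module.End ℂ (P →₀ ℂ)}
    (hT : ∀ p q, T (Finsupp.single p 1) q ≠ 0 → w q = w p) : Commute (diagOp w) T := by
  refine Finsupp.lhom_ext' fun p => LinearMap.ext_ring (Finsupp.ext fun q => ?_)
  simp only [LinearMap.comp_apply, Finsupp.lsingle_apply, Module.End.mul_apply, diagOp_single,
    map_smul, diagOp_apply, Finsupp.smul_apply, smul_eq_mul]
  by_cases h : T (Finsupp.single p 1) q = 0
  · simp [h]
  · rw [hT p q h]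

theorem invDeg_commute_kosD : Commute (invDeg n) (kosD n) :=
  diagOp_commute fun p q h => by
    obtain ⟨h1, h2⟩ := kosD_single_apply_ne_zero h
    have : totalDeg q = totalDeg p := by rw [totalDeg, totalDeg]; omega
    rw [this]

theorem invDeg_commute_derD : Commute (invDeg n) (derD n) :=
  diagOp_commute fun p q h => by
    obtain ⟨h1, h2⟩ := derD_single_apply_ne_zero h
    have : totalDeg q = totalDeg p := by rw [totalDeg, totalDeg]; omega
    rw [this]

/-- The right side is the identity away from `(0, ∅)` and zero there, by the convention `0⁻¹ = 0`:
the complement of the projection onto `ℂ`. -/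
theorem kosD_homotopy : kosD n * (invDeg n * derD n) + (invDeg n * derD n) * kosD n =
    diagOp fun p => (totalDeg p : ℂ)⁻¹ * totalDeg p := by
  rw [← mul_assoc, ← invDeg_commute_kosD.eq, mul_assoc, mul_assoc, ← mul_add, kosD_mul_derD_add]
  refine Finsupp.lhom_ext' fun p => LinearMap.ext_ring (Finsupp.ext fun q => ?_)
  simp only [LinearMap.comp_apply, Finsupp.lsingle_apply, Module.End.mul_apply, diagOp_apply,
    invDeg, mul_assoc]

theorem derD_homotopy : derD n * (invDeg n * kosD n) + (invDeg n * kosD n) * derD n =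
    diagOp fun p => (totalDeg p : ℂ)⁻¹ * totalDeg p := by
  rw [← kosD_homotopy, ← mul_assoc, ← invDeg_commute_derD.eq, ← mul_assoc (kosD n),
    ← invDeg_commute_kosD.eq, add_comm, mul_assoc, mul_assoc]

theorem diagOp_totalDeg_single {p : (Fin n →₀ ℕ) × Finset (Fin n)} (hp : p ≠ (0, ∅)) :
    diagOp (fun p => (totalDeg p : ℂ)⁻¹ * totalDeg p) (Finsupp.single p 1) =
      Finsupp.single p 1 := by
  rw [diagOp_single, inv_mul_cancel₀, one_smul]
  exact_mod_cast fun h => hp (totalDeg_eq_zero.1 h)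

theorem diagOp_totalDeg_single_zero :
    diagOp (fun p => (totalDeg p : ℂ)⁻¹ * totalDeg p)
      (Finsupp.single ((0, ∅) : (Fin n →₀ ℕ) × Finset (Fin n)) 1) = 0 := by
  rw [diagOp_single, totalDeg_eq_zero.2 rfl]
  simp

end Complex

section Main

variable {n : ℕ} {V : Type*} [AddCommGroup V] [Module ℂ V] (x : Module.Basis (Fin n) ℂ V)

/-! ### `S(V)` with its action of `T` -/

section Sym

theorem symAlgAction_gen (s : CTwoPow n) (j : Fin n) :
    symAlgAction x s (SymmetricAlgebra.ι ℂ V (x j)) =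
      ((s j : ℤ) : ℂ) • SymmetricAlgebra.ι ℂ V (x j) := by
  simp [symAlgAction, diagAction]

theorem symmetricAlgebra_basis_zero : x.symmetricAlgebra 0 = 1 := by
  simp only [Module.Basis.symmetricAlgebra, Module.Basis.map_apply,
    MvPolynomial.coe_basisMonomials, AlgEquiv.toLinearEquiv_apply]
  exact map_one (SymmetricAlgebra.equivMvPolynomial x).symm

theorem symmetricAlgebra_basis_add (a b : Fin n →₀ ℕ) :
    x.symmetricAlgebra (a + b) = x.symmetricAlgebra a * x.symmetricAlgebra b := by
  simp only [Module.Basis.symmetricAlgebra, Module.Basis.map_apply,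
    MvPolynomial.coe_basisMonomials, AlgEquiv.toLinearEquiv_apply]
  rw [← map_mul, MvPolynomial.monomial_mul, one_mul]

theorem symmetricAlgebra_basis_single (i : Fin n) :
    x.symmetricAlgebra (Finsupp.single i 1) = SymmetricAlgebra.ι ℂ V (x i) := by
  simp only [Module.Basis.symmetricAlgebra, Module.Basis.map_apply,
    MvPolynomial.coe_basisMonomials, AlgEquiv.toLinearEquiv_apply]
  exact SymmetricAlgebra.equivMvPolynomial_symm_X x i

/-- Monomials are weight vectors. For `s = tAbove i` the weight is `moveSign i a` by definition. -/
theorem symAlgAction_basis (s : CTwoPow n) (a : Fin n →₀ ℕ) :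
    symAlgAction x s (x.symmetricAlgebra a) =
      (∏ j, ((s j : ℤ) : ℂ) ^ a j) • x.symmetricAlgebra a := by
  have hadd : ∀ f g : Fin n →₀ ℕ,
      symAlgAction x s (x.symmetricAlgebra f) =
        (∏ j, ((s j : ℤ) : ℂ) ^ f j) • x.symmetricAlgebra f →
      symAlgAction x s (x.symmetricAlgebra g) =
        (∏ j, ((s j : ℤ) : ℂ) ^ g j) • x.symmetricAlgebra g →
      symAlgAction x s (x.symmetricAlgebra (f + g)) =
        (∏ j, ((s j : ℤ) : ℂ) ^ (f + g) j) • x.symmetricAlgebra (f + g) := fun f g hf hg => by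
    rw [symmetricAlgebra_basis_add, map_mul, hf, hg, smul_mul_smul_comm, ← Finset.prod_mul_distrib]
    simp only [Finsupp.add_apply, pow_add]
  have h0 : symAlgAction x s (x.symmetricAlgebra 0) =
      (∏ j, ((s j : ℤ) : ℂ) ^ (0 : Fin n →₀ ℕ) j) • x.symmetricAlgebra 0 := by
    rw [symmetricAlgebra_basis_zero, map_one]
    simp
  induction a using Finsupp.induction_linear with
  | zero => exact h0
  | add f g hf hg => exact hadd f g hf hg
  | single i m =>
    induction m with
    | zero => rw [Finsupp.single_zero]; exact h0
    | succ m ih =>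
      rw [Finsupp.single_add]
      refine hadd _ _ ih ?_
      rw [symmetricAlgebra_basis_single, symAlgAction_gen, Finset.prod_eq_single i]
      · rw [Finsupp.single_eq_same, pow_one]
      · intro j _ hj
        rw [Finsupp.single_eq_of_ne hj, pow_zero]
      · simp

theorem exists_symTwist_equiv :
    ∃ e : SymTwist x ≃ₐ[ℂ] QuadAlg (extRel x (-negOne n)),
      (∀ v, e (DrinfeldTwist.of (SymmetricAlgebra.ι ℂ V v)) = QuadAlg.gen _ v) ∧
      ∀ m, (symTwistGrading x m).map e.toLinearMap =
        powGrading (QuadAlg.gen (extRel x (-negOne n))) m := by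
  have h := exists_symmetricAlgebra_equiv_quadAlg x
  rw [symRel_eq_extRel] at h
  obtain ⟨e₀, he₀⟩ := h
  have h2 := exists_twist_equiv x (symAlgAction_gen x) _ e₀ he₀
  rw [show (-fun _ _ => 1 : Fin n → Fin n → ℂ) * negOne n = -negOne n by
    funext i j; simp] at h2
  exact h2

/-- A basis of monomials of `S_{-1}(V)`. -/
theorem exists_quantumSym_basis :
    ∃ m : Module.Basis (Fin n →₀ ℕ) ℂ (QuadAlg (extRel x (-negOne n))), m 0 = 1 ∧
      ∀ a i, m a * QuadAlg.gen _ (x i) = moveSign i a • m (a + Finsupp.single i 1) := by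
  obtain ⟨e, he, -⟩ := exists_symTwist_equiv x
  refine ⟨x.symmetricAlgebra.map
    ((DrinfeldTwist.of : SymmetricAlgebra ℂ V ≃ₗ[ℂ] SymTwist x).trans e.toLinearEquiv), ?_, ?_⟩
  · rw [Module.Basis.map_apply, symmetricAlgebra_basis_zero]
    exact map_one e
  · intro a i
    rw [Module.Basis.map_apply, Module.Basis.map_apply, ← he]
    change e _ * e _ = _ • e _
    rw [← map_mul, ← map_smul]
    refine congrArg e ?_
    -- Right multiplication by `x i` in the twist applies `tAbove i` to the monomial, whence the
    -- sign.
    refine (of_mul_gen x (symAlgAction_gen x) i _).trans ?_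
    rw [symAlgAction_basis, smul_mul_assoc, symmetricAlgebra_basis_add,
      symmetricAlgebra_basis_single]
    rfl

end Sym

/-! ### The twist of `Λ(V)` and the squarefree monomial basis of `Λ_{-1}(V)` -/

section Ext

theorem extAlgAction_gen (s : CTwoPow n) (j : Fin n) :
    extAlgAction x s (ExteriorAlgebra.ι ℂ (x j)) =
      ((s j : ℤ) : ℂ) • ExteriorAlgebra.ι ℂ (x j) := by
  simp [extAlgAction, diagAction]

theorem exists_extTwist_equiv :
    ∃ e : ExtTwist x ≃ₐ[ℂ] QuadAlg (extRel x (negOne n)),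
      (∀ v, e (DrinfeldTwist.of (ExteriorAlgebra.ι ℂ v)) = QuadAlg.gen _ v) ∧
      ∀ m, (extTwistGrading x m).map e.toLinearMap =
        powGrading (QuadAlg.gen (extRel x (negOne n))) m := by
  obtain ⟨e₀, he₀⟩ := exists_exteriorAlgebra_equiv_quadAlg x
  have h2 := exists_twist_equiv x (extAlgAction_gen x) _ e₀ he₀
  rw [show (fun _ _ => 1 : Fin n → Fin n → ℂ) * negOne n = negOne n by
    funext i j; simp] at h2
  exact h2

theorem quantumExt_gen_sq (i : Fin n) :
    QuadAlg.gen (extRel x (negOne n)) (x i) * QuadAlg.gen _ (x i) = 0 := by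
  have h := extRel_gen_mul x (negOne n) i i
  have h2 : (2 : ℂ) • (QuadAlg.gen (extRel x (negOne n)) (x i) * QuadAlg.gen _ (x i)) = 0 := by
    rw [two_smul]
    simpa [negOne] using h
  exact (smul_eq_zero.1 h2).resolve_left two_ne_zero

theorem quantumExt_gen_commute (i j : Fin n) :
    Commute (QuadAlg.gen (extRel x (negOne n)) (x i)) (QuadAlg.gen _ (x j)) := by
  by_cases hij : i = j
  · rw [hij]
  · have h := extRel_gen_mul x (negOne n) i j
    rw [commute_iff_eq, ← sub_eq_zero]
    convert h using 1
    rw [sub_eq_add_neg, negOne, if_neg hij]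
    exact congrArg _ (neg_one_smul ℂ _).symm

/-- The squarefree monomials in `Λ_{-1}(V)`. -/
def extMonomial (b : Finset (Fin n)) : QuadAlg (extRel x (negOne n)) :=
  b.noncommProd (fun i => QuadAlg.gen _ (x i)) fun i _ j _ _ => quantumExt_gen_commute x i j

theorem extMonomial_empty : extMonomial x ∅ = 1 := Finset.noncommProd_empty _ _

theorem gen_mul_extMonomial (i : Fin n) (b : Finset (Fin n)) :
    QuadAlg.gen _ (x i) * extMonomial x b = if i ∈ b then 0 else extMonomial x (insert i b) := by
  have h : ∀ b : Finset (Fin n), i ∉ b →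
      extMonomial x (insert i b) = QuadAlg.gen _ (x i) * extMonomial x b := fun b hb =>
    Finset.noncommProd_insert_of_notMem _ _ _ _ hb
  split_ifs with hi
  · rw [← Finset.insert_erase hi, h _ (Finset.notMem_erase i b), ← mul_assoc, quantumExt_gen_sq,
      zero_mul]
  · exact (h b hi).symm

theorem extMonomial_mul_gen (b : Finset (Fin n)) (i : Fin n) :
    extMonomial x b * QuadAlg.gen _ (x i) = if i ∈ b then 0 else extMonomial x (insert i b) := by
  rw [← gen_mul_extMonomial]
  exact commute_of_generators x QuadAlg.adjoin_range_gen (quantumExt_gen_commute x) _ _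

/-- Multiplication by a generator on squarefree monomials. -/
def insertOp (i : Fin n) : Module.End ℂ (Finset (Fin n) →₀ ℂ) :=
  Finsupp.linearCombination ℂ fun b => if i ∈ b then 0 else Finsupp.single (insert i b) 1

theorem insertOp_single (i : Fin n) (b : Finset (Fin n)) :
    insertOp i (Finsupp.single b 1) = if i ∈ b then 0 else Finsupp.single (insert i b) 1 := by
  rw [insertOp, Finsupp.linearCombination_single, one_smul]

/-- This makes the space on the subsets a module over `Λ_{-1}(V)`. Acting on the vector of `∅` then
separates the squarefree monomials and proves them independent. -/
theorem insertOp_relation (i j : Fin n) :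
    insertOp i * insertOp j + negOne n i j • (insertOp j * insertOp i) = 0 := by
  refine Finsupp.lhom_ext' fun b => LinearMap.ext_ring ?_
  simp only [LinearMap.comp_apply, Finsupp.lsingle_apply, LinearMap.add_apply,
    Module.End.mul_apply, LinearMap.smul_apply, LinearMap.zero_apply, insertOp_single]
  by_cases hij : i = j
  · subst hij
    split_ifs <;> simp only [map_zero, smul_zero, add_zero, insertOp_single,
      Finset.mem_insert_self, if_true]
  · by_cases hi : i ∈ b <;> by_cases hj : j ∈ b <;>
      simp only [hi, hj, hij, Ne.symm hij, if_true, if_false, map_zero, smul_zero, add_zero,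
        insertOp_single, Finset.mem_insert, or_true, or_false, negOne]
    rw [Finset.insert_comm, neg_smul, one_smul, add_neg_cancel]

/-- A basis of monomials of `Λ_{-1}(V)`. -/
theorem exists_quantumExt_basis :
    ∃ m : Module.Basis (Finset (Fin n)) ℂ (QuadAlg (extRel x (negOne n))),
      ∀ b, m b = extMonomial x b := by
  let Γ : QuadAlg (extRel x (negOne n)) →ₐ[ℂ] Module.End ℂ (Finset (Fin n) →₀ ℂ) :=
    extRelLift insertOp insertOp_relation
  have hΓ : ∀ i, Γ (QuadAlg.gen _ (x i)) = insertOp i := fun i => extRelLift_gen x _ _ i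
  let f : QuadAlg (extRel x (negOne n)) →ₗ[ℂ] (Finset (Fin n) →₀ ℂ) :=
    LinearMap.applyₗ (Finsupp.single ∅ 1) ∘ₗ Γ.toLinearMap
  have hf : ∀ q, f q = Γ q (Finsupp.single ∅ 1) := fun q => rfl
  let g : (Finset (Fin n) →₀ ℂ) →ₗ[ℂ] QuadAlg (extRel x (negOne n)) :=
    Finsupp.linearCombination ℂ (extMonomial x)
  have hg : ∀ b, g (Finsupp.single b 1) = extMonomial x b := fun b => by
    rw [Finsupp.linearCombination_single, one_smul]
  have hgi : ∀ i l, g (insertOp i l) = QuadAlg.gen _ (x i) * g l := by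
    intro i l
    have h : g ∘ₗ insertOp i = LinearMap.mulLeft ℂ (QuadAlg.gen _ (x i)) ∘ₗ g := by
      refine Finsupp.lhom_ext' fun b => LinearMap.ext_ring ?_
      simp only [LinearMap.comp_apply, Finsupp.lsingle_apply, LinearMap.mulLeft_apply, hg,
        gen_mul_extMonomial, insertOp_single]
      split_ifs
      · rw [map_zero]
      · rw [hg]
    exact LinearMap.congr_fun h l
  have hgf : ∀ q, g (f q) = q := by
    refine left_mul_induction x QuadAlg.adjoin_range_gen ?_ ?_ ?_ ?_
    · rw [hf, map_one Γ, Module.End.one_apply, hg, extMonomial_empty]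
    · intro a b ha hb; rw [map_add, map_add, ha, hb]
    · intro r a ha; rw [map_smul, map_smul, ha]
    · intro i a ha
      rw [hf, map_mul Γ, Module.End.mul_apply, hΓ, hgi, ← hf, ha]
  have hfg : ∀ b, f (extMonomial x b) = Finsupp.single b 1 := by
    intro b
    induction b using Finset.induction_on with
    | empty => rw [extMonomial_empty, hf, map_one Γ, Module.End.one_apply]
    | insert i b hi ih =>
      have h := gen_mul_extMonomial x i b
      rw [if_neg hi] at h
      rw [← h, hf, map_mul Γ, Module.End.mul_apply, hΓ, ← hf, ih, insertOp_single, if_neg hi]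
  let E : QuadAlg (extRel x (negOne n)) ≃ₗ[ℂ] (Finset (Fin n) →₀ ℂ) :=
    LinearEquiv.ofLinearMap f g (Finsupp.lhom_ext' fun b => LinearMap.ext_ring (by
      simp only [LinearMap.comp_apply, Finsupp.lsingle_apply, hg, hfg, LinearMap.id_apply]))
      (LinearMap.ext hgf)
  exact ⟨Module.Basis.ofRepr E, fun b => hg b⟩

end Ext

/-! ### Koszulness -/

/-- The free modules are indexed by the subsets `b`. The differential removes `i` from `b` and
multiplies the coefficient by `x i` on the right, so it is left linear; in the monomial basis it is
`kosD`. -/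
theorem isKoszul_quantumSym : IsKoszul (powGrading (QuadAlg.gen (extRel x (-negOne n)))) := by
  obtain ⟨m, hm₀, hm⟩ := exists_quantumSym_basis x
  have : Module.Finite ℂ V := Module.Finite.of_basis x
  refine isKoszul_of_coord (QuadAlg.isConnectedGraded _)
    (aug := QuadAlg.aug _) (fun m hm a ha => QuadAlg.aug_eq_zero hm ha)
    (J := Finset (Fin n)) (Equiv.prodComm _ _) (deg := Finset.card) (dg := fun p => p.2.card)
    (fun j i => rfl) (j₀ := ∅) (fun j => Finset.card_eq_zero) m (i₀ := 0) hm₀ ?_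
    (fun b => ∑ i ∈ b, Finsupp.single (b.erase i) (QuadAlg.gen _ (x i))) ?_
    (kosD n) (invDeg n * derD n) ?_ ?_ ?_ kosD_sq ?_ ?_
  · intro a ha
    -- A monomial other than `1` is, up to sign, a product ending in a generator, so the
    -- augmentation kills it.
    obtain ⟨i, hi⟩ := Finsupp.ne_iff.1 ha
    have h2 : a = (a - Finsupp.single i 1) + Finsupp.single i 1 := by
      rw [tsub_add_cancel_of_le]
      rwa [Finsupp.single_le_iff, Nat.one_le_iff_ne_zero]
    have h := congrArg (QuadAlg.aug _) (hm (a - Finsupp.single i 1) i)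
    rw [map_mul, QuadAlg.aug_gen, mul_zero, ← h2, map_smul] at h
    refine (smul_eq_zero.1 h.symm).resolve_left fun h3 => ?_
    have h4 := moveSign_mul_self i (a - Finsupp.single i 1)
    rw [h3, zero_mul] at h4
    exact zero_ne_one h4
  · intro b b'
    rw [Finsupp.finsetSum_apply]
    refine sum_mem fun i _ => ?_
    classical
    rw [Finsupp.single_apply]
    split_ifs
    · exact mem_powGrading_one _ _
    · exact zero_mem _
  · intro b a
    rw [Equiv.prodComm_apply, Prod.swap, kosD_single, Finset.smul_sum, map_sum,
      ← Finset.sum_filter, Finset.filter_mem_eq_inter, Finset.univ_inter]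
    refine Finset.sum_congr rfl fun i _ => ?_
    rw [Finsupp.smul_single, smul_eq_mul, hm, ← Finsupp.smul_single, map_smul, freeCoord_single]
    rfl
  · exact fun p q h => (kosD_single_apply_ne_zero h).2
  · intro p q h
    rw [Module.End.mul_apply, invDeg, diagOp_apply] at h
    exact (derD_single_apply_ne_zero (right_ne_zero_of_mul h)).2
  · intro p hp
    have := LinearMap.congr_fun (kosD_homotopy (n := n)) (Finsupp.single p 1)
    rwa [diagOp_totalDeg_single hp] at this
  · have := LinearMap.congr_fun (kosD_homotopy (n := n)) (Finsupp.single (0, ∅) 1)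
    rwa [diagOp_totalDeg_single_zero] at this

/-- The same complex with the roles exchanged: the free modules are indexed by the exponents `a`,
the differential is `derD`, and `kosD` provides the homotopy. -/
theorem isKoszul_quantumExt : IsKoszul (powGrading (QuadAlg.gen (extRel x (negOne n)))) := by
  obtain ⟨m, hm⟩ := exists_quantumExt_basis x
  have : Module.Finite ℂ V := Module.Finite.of_basis x
  refine isKoszul_of_coord (QuadAlg.isConnectedGraded _)
    (aug := QuadAlg.aug _) (fun m hm a ha => QuadAlg.aug_eq_zero hm ha)
    (J := Fin n →₀ ℕ) (Equiv.refl _) (deg := Finsupp.degree) (dg := fun p => p.1.degree)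
    (fun j i => rfl) (j₀ := 0) (fun j => Finsupp.degree_eq_zero_iff j) m (i₀ := ∅)
    (by rw [hm, extMonomial_empty]) ?_
    -- The factor `a i` removes the terms in which the exponent subtraction truncates.
    (fun a => ∑ i, Finsupp.single (a - Finsupp.single i 1)
      ((a i * moveSign i a : ℂ) • QuadAlg.gen _ (x i))) ?_
    (derD n) (invDeg n * kosD n) ?_ ?_ ?_ derD_sq ?_ ?_
  · intro b hb
    obtain ⟨i, hi⟩ := Finset.nonempty_iff_ne_empty.2 hb
    have h := gen_mul_extMonomial x i (b.erase i)
    rw [if_neg (Finset.notMem_erase i b), Finset.insert_erase hi] at h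
    rw [hm, ← h, map_mul, QuadAlg.aug_gen, zero_mul]
  · intro b b'
    rw [Finsupp.finsetSum_apply]
    refine sum_mem fun i _ => ?_
    classical
    rw [Finsupp.single_apply]
    split_ifs
    · exact Submodule.smul_mem _ _ (mem_powGrading_one _ _)
    · exact zero_mem _
  · intro a b
    rw [Equiv.refl_apply, derD_single, Finset.smul_sum, map_sum]
    refine Finset.sum_congr rfl fun i _ => ?_
    rw [Finsupp.smul_single, smul_eq_mul, mul_smul_comm, hm, extMonomial_mul_gen,
      ← Finsupp.smul_single, map_smul]
    split_ifs
    · rw [Finsupp.single_zero, map_zero, smul_zero]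
    · rw [← hm, freeCoord_single]
      rfl
  · exact fun p q h => (derD_single_apply_ne_zero h).1
  · intro p q h
    rw [Module.End.mul_apply, invDeg, diagOp_apply] at h
    exact (kosD_single_apply_ne_zero (right_ne_zero_of_mul h)).1
  · intro p hp
    have := LinearMap.congr_fun (derD_homotopy (n := n)) (Finsupp.single p 1)
    rwa [diagOp_totalDeg_single hp] at this
  · have := LinearMap.congr_fun (derD_homotopy (n := n)) (Finsupp.single (0, ∅) 1)
    rwa [diagOp_totalDeg_single_zero] at this

end Main

end KoszulTwist

end

theorem mainTheorem4 {n : ℕ} (hn : 2 ≤ n) {V : Type*} [AddCommGroup V] [Module ℂ V]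
    (x : Module.Basis (Fin n) ℂ V) :
    -- `μ` is a counital 2-cocycle of `H = ℂT`, given by the stated product, and `μ = μ⁻¹`
    (((mu n : (GroupAlg n ⊗[ℂ] GroupAlg n)ˣ) : GroupAlg n ⊗[ℂ] GroupAlg n) =
        ∏ p : Fin n × Fin n with p.2 < p.1, muFactor p.1 p.2 ∧
      IsCounitalTwoCocycle (mu n) ∧ (mu n)⁻¹ = mu n) ∧
    -- the symmetric algebra: `S(V) = T(V)/(R)` is an `H`-module algebra, with `H` acting by
    -- degree-preserving endomorphisms and `t i ▷ x j = (-1)^{δ_ij} x j`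
    ((∃ e : SymmetricAlgebra ℂ V ≃ₐ[ℂ] QuadAlg (symRel x fun _ _ => 1),
        ∀ v, e (SymmetricAlgebra.ι ℂ V v) = QuadAlg.gen _ v) ∧
      IsModuleAlgebra (symAction x) ∧
      (∀ i j, symAction x (tH i) (SymmetricAlgebra.ι ℂ V (x j)) =
        (if i = j then (-1 : ℂ) else 1) • SymmetricAlgebra.ι ℂ V (x j)) ∧
      (∀ h m, ∀ a ∈ powGrading (SymmetricAlgebra.ι ℂ V) m,
        symAction x h a ∈ powGrading (SymmetricAlgebra.ι ℂ V) m) ∧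
      -- `R_μ = μ ▷ R` is the space of relations of `S_{-1}(V)`
      (symRel x fun _ _ => 1).map (tensorAction (vAction x) (vAction x) (mu n).val) =
        symRel x (negOne n) ∧
      -- `S(V)_μ = S_{-1}(V)` as graded algebras, by the identity on `V`
      (∃ e : SymTwist x ≃ₐ[ℂ] QuantumSym x (negOne n),
        (∀ v, e (DrinfeldTwist.of (SymmetricAlgebra.ι ℂ V v)) = QuadAlg.gen _ v) ∧
        ∀ m, (symTwistGrading x m).map e.toLinearMap =
          powGrading (QuadAlg.gen (symRel x (negOne n))) m) ∧
      IsKoszul (symTwistGrading x) ∧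
      IsKoszul (powGrading (QuadAlg.gen (symRel x (negOne n))))) ∧
    -- the exterior algebra, likewise
    ((∃ e : ExteriorAlgebra ℂ V ≃ₐ[ℂ] QuadAlg (extRel x fun _ _ => 1),
        ∀ v, e (ExteriorAlgebra.ι ℂ v) = QuadAlg.gen _ v) ∧
      IsModuleAlgebra (extAction x) ∧
      (∀ i j, extAction x (tH i) (ExteriorAlgebra.ι ℂ (x j)) =
        (if i = j then (-1 : ℂ) else 1) • ExteriorAlgebra.ι ℂ (x j)) ∧
      (∀ h m, ∀ a ∈ powGrading (ExteriorAlgebra.ι ℂ (M := V)) m,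
        extAction x h a ∈ powGrading (ExteriorAlgebra.ι ℂ (M := V)) m) ∧
      (extRel x fun _ _ => 1).map (tensorAction (vAction x) (vAction x) (mu n).val) =
        extRel x (negOne n) ∧
      extRel x (negOne n) =
        Submodule.span ℂ ({r | ∃ i, r = x i ⊗ₜ[ℂ] x i} ∪
          {r | ∃ i j, i ≠ j ∧ r = x i ⊗ₜ[ℂ] x j - x j ⊗ₜ[ℂ] x i}) ∧
      (∃ e : ExtTwist x ≃ₐ[ℂ] QuantumExt x (negOne n),
        (∀ v, e (DrinfeldTwist.of (ExteriorAlgebra.ι ℂ v)) = QuadAlg.gen _ v) ∧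
        ∀ m, (extTwistGrading x m).map e.toLinearMap =
          powGrading (QuadAlg.gen (extRel x (negOne n))) m) ∧
      IsKoszul (extTwistGrading x) ∧
      IsKoszul (powGrading (QuadAlg.gen (extRel x (negOne n))))) := by
  have hmap := map_mu_extRel x (-fun _ _ => 1)
  rw [← symRel_eq_extRel, show (-fun _ _ => 1 : Fin n → Fin n → ℂ) * negOne n = -negOne n by
    funext i j; simp, ← symRel_eq_extRel] at hmap
  have hmap' := map_mu_extRel x (fun _ _ => 1)
  rw [show (fun _ _ => 1 : Fin n → Fin n → ℂ) * negOne n = negOne n by funext i j; simp] at hmap'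
  have hsym := exists_symTwist_equiv x
  have hkos := isKoszul_quantumSym x
  rw [← symRel_eq_extRel] at hsym hkos
  obtain ⟨e, he, heg⟩ := hsym
  obtain ⟨e', he', heg'⟩ := exists_extTwist_equiv x
  -- Both equalities are definitional, `mu n` being the unit built from `muElem n` with itself as
  -- inverse.
  exact ⟨⟨rfl, mu_isCounitalTwoCocycle n, rfl⟩,
    ⟨exists_symmetricAlgebra_equiv_quadAlg x, symAction_isModuleAlgebra x,
      algAction_tH_gen x (symAlgAction_gen x),
      fun h _ _ ha => algAction_mem_powGrading x (symAlgAction_gen x) h ha, hmap,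
      ⟨e, he, heg⟩, hkos.of_algEquiv e heg, hkos⟩,
    ⟨exists_exteriorAlgebra_equiv_quadAlg x, extAction_isModuleAlgebra x,
      algAction_tH_gen x (extAlgAction_gen x),
      fun h _ _ ha => algAction_mem_powGrading x (extAlgAction_gen x) h ha, hmap',
      extRel_negOne x, ⟨e', he', heg'⟩, (isKoszul_quantumExt x).of_algEquiv e' heg',
      isKoszul_quantumExt x⟩⟩
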